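/- Let $1\le p<q$ be integers, $\mathbf{BS}(p,q)=\langle a,t\mid ta^pt^{-1}=a^q\rangle$, and read words over $\{t,T,a,A\}$ as elements of $\mathbf{BS}(p,q)$ with $T=t^{-1}$, $A=a^{-1}$; write $u\sim v$ if $u$ and $v$ denote the same element. Order words by length first and, for equal length, lexicographically with $t<T<a<A$; let $\mathrm{llnf}(w)$ be the first word $v$ with $v\sim w$. A word is *horocyclic* if it denotes an element of the horocyclic subgroup $\langle a\rangle$. A *slope* is a word $\alpha_0T\alpha_1\cdots T\alpha_k$ with $k\ge 0$ and $\alpha_i\in\mathbb Z$, where $\alpha$ stands for the word $a^\alpha$ ($=A^{-\alpha}$ if $\alpha<0$). A slope $w$ is *semi-horocyclic* if $t^kw$ is horocyclic for some $k\in\mathbb N$. 1. The set of slopes $w$ with $w=\mathrm{llnf}(w)$ is a regular language. 2. If $p\mid q$, then the set of semi-horocyclic slopes $w$ with $w=\mathrm{llnf}(w)$ is a regular language. 3. If $p\mid q$, then the set of horocyclic words $w\in\{t,T,a,A\}^*$ with $w=\mathrm{llnf}(w)$ is a deterministic linear one-counter language, i.e. it is accepted by a deterministic one-counter automaton with finitely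 many states in whose computations the counter never increases after it has decreased; it is generated by an unambiguous linear context-free grammar; and it is recognized by a deterministic Turing machine (read-only input tape, one work tape) that halts on every input and uses work space $O(\log n)$ on inputs of length $n$. Moreover, the growth series $\sum_{n\ge 0}\#\{g\in\langle a\rangle : |g|=n\}\,x^n$ of the horocyclic subgroup, where $|g|$ is the length of a shortest word over $\{t,T,a,A\}$ denoting $g$, is a rational function. -/

import Mathlib

/-! ### Baumslag-Solitar groups, words and length-lexicographical normal forms -/

namespace BSol

/-- The two generators of a Baumslag-Solitar group. -/
inductive Gen
  | a
  | t

/-- The Baumslag-Solitar group `BS(p, q) = ⟨a, t ∣ t a^p t⁻¹ = a^q⟩`. -/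
abbrev BS (p q : ℕ) : Type :=
  PresentedGroup
    ({FreeGroup.of Gen.t * FreeGroup.of Gen.a ^ p * (FreeGroup.of Gen.t)⁻¹ *
        (FreeGroup.of Gen.a ^ q)⁻¹} : Set (FreeGroup Gen))

/-- The element `a` of `BS(p, q)`. -/
def genA (p q : ℕ) : BS p q := PresentedGroup.of Gen.a

/-- The element `t` of `BS(p, q)`. -/
def genT (p q : ℕ) : BS p q := PresentedGroup.of Gen.t

/-- The alphabet `{t, T, a, A}`, where `T` and `A` are read as `t⁻¹` and `a⁻¹`. -/
inductive Letter
  | t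
  | T
  | a
  | A
  deriving DecidableEq

/-- The position of a letter in the order `t < T < a < A`. -/
def Letter.rank : Letter → ℕ
  | .t => 0
  | .T => 1
  | .a => 2
  | .A => 3

/-- The strict order `t < T < a < A` on letters. -/
def Letter.Before (x y : Letter) : Prop := x.rank < y.rank

/-- The group element denoted by a letter. -/
def letterVal (p q : ℕ) : Letter → BS p q
  | .t => genT p q
  | .T => (genT p q)⁻¹
  | .a => genA p q
  | .A => (genA p q)⁻¹

/-- The group element denoted by a word. -/
def eval (p q : ℕ) (w : List Letter) : BS p q := (w.map (letterVal p q)).prod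

theorem shortlex_wf : WellFounded (List.Shortlex Letter.Before) :=
  List.Shortlex.wf (InvImage.wf Letter.rank Nat.lt_wfRel.wf)

/-- The length-lexicographical normal form of `w`: the first word, in the length-lexicographical
order coming from `t < T < a < A`, that denotes the same group element as `w`. -/
noncomputable def llnf (p q : ℕ) (w : List Letter) : List Letter :=
  shortlex_wf.min {v | eval p q v = eval p q w} ⟨w, rfl⟩

/-- The word `a^n` (that is, `A^(-n)` when `n` is negative). -/
def powWord (n : ℤ) : List Letter :=
  if 0 ≤ n then List.replicate n.natAbs Letter.a else List.replicate n.natAbs Letter.A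

/-- A slope is a word `α₀ T α₁ ⋯ T αₖ` with integers `αᵢ` (and `k ≥ 0`), the integer `α` being
identified with the word `a^α`. -/
def IsSlope (w : List Letter) : Prop :=
  ∃ (α₀ : ℤ) (αs : List ℤ), w = powWord α₀ ++ αs.flatMap (fun α => Letter.T :: powWord α)

/-- The horocyclic subgroup `⟨a⟩`. -/
def horocyclicSubgroup (p q : ℕ) : Subgroup (BS p q) := Subgroup.zpowers (genA p q)

/-- A word is horocyclic if it denotes an element of `⟨a⟩`. -/
def IsHorocyclic (p q : ℕ) (w : List Letter) : Prop := eval p q w ∈ horocyclicSubgroup p q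

/-- A slope `w` is semi-horocyclic if `t^k w` is horocyclic for some `k`. -/
def IsSemiHorocyclic (p q : ℕ) (w : List Letter) : Prop :=
  IsSlope w ∧ ∃ k : ℕ, IsHorocyclic p q (List.replicate k Letter.t ++ w)

/-- The slopes in length-lexicographical normal form. -/
def slopeLang (p q : ℕ) : Language Letter := {w | IsSlope w ∧ llnf p q w = w}

/-- The semi-horocyclic slopes in length-lexicographical normal form. -/
def semiHorocyclicLang (p q : ℕ) : Language Letter :=
  {w | IsSemiHorocyclic p q w ∧ llnf p q w = w}

/-- The horocyclic words in length-lexicographical normal form. -/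
def horocyclicLang (p q : ℕ) : Language Letter := {w | IsHorocyclic p q w ∧ llnf p q w = w}

/-- The geodesic length of a group element with respect to the generators `a, t`. -/
noncomputable def geodesicLength (p q : ℕ) (g : BS p q) : ℕ :=
  sInf {n | ∃ w : List Letter, eval p q w = g ∧ w.length = n}

/-- The growth series `∑ₙ #{g ∈ ⟨a⟩ ∣ g has geodesic length n} Xⁿ` of the horocyclic subgroup;
the geodesic length is the one in the whole group. -/
noncomputable def horocyclicGrowth (p q : ℕ) : PowerSeries ℚ :=
  PowerSeries.mk fun n =>
    (Set.ncard {g : BS p q | g ∈ horocyclicSubgroup p q ∧ geodesicLength p q g = n} : ℚ)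

/-- A power series is (the expansion at `0` of) a rational function. -/
def IsRationalSeries (f : PowerSeries ℚ) : Prop :=
  ∃ P Q : Polynomial ℚ, Q.coeff 0 ≠ 0 ∧ (Q : PowerSeries ℚ) * f = (P : PowerSeries ℚ)

/-! ### Deterministic one-counter automata -/

/-- The effect of a move on the counter. -/
inductive CounterOp
  | dec
  | keep
  | inc

/-- The new counter value; a decrement of the value `0` is impossible. -/
def CounterOp.apply : CounterOp → ℕ → Option ℕ
  | .dec, 0 => none
  | .dec, n + 1 => some n
  | .keep, n => some n
  | .inc, n => some (n + 1)

/-- A deterministic one-counter automaton over the alphabet `α` with states `σ`, i.e. a deterministic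
pushdown automaton with one stack symbol besides the bottom marker. `move s z (some x)` is the
move that reads the letter `x` and `move s z none` is the move that reads nothing, in
the state `s` and with `z` telling whether the counter is zero. -/
structure OneCounter (α σ : Type) where
  start : σ
  accept : Set σ
  move : σ → Bool → Option α → Option (σ × CounterOp)
  det : ∀ s z, move s z none ≠ none → ∀ x, move s z (some x) = none

namespace OneCounter

variable {α σ : Type}

/-- One move between configurations (state and counter value), labelled by what is read. -/
def Step (M : OneCounter α σ) (c : σ × ℕ) (x : Option α) (d : σ × ℕ) : Prop :=
  ∃ op, M.move c.1 (decide (c.2 = 0)) x = some (d.1, op) ∧ op.apply c.2 = some d.2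

/-- `M.Run c w d`: some sequence of moves leads from `c` to `d` and reads exactly `w`. -/
inductive Run (M : OneCounter α σ) : σ × ℕ → List α → σ × ℕ → Prop
  | refl (c) : Run M c [] c
  | silent {c d e w} : M.Step c none d → Run M d w e → Run M c w e
  | read {c d e x w} : M.Step c (some x) d → Run M d w e → Run M c (x :: w) e

/-- The accepted language: the automaton starts with counter `0` and accepts by final state. -/
def language (M : OneCounter α σ) : Language α :=
  {w | ∃ c, M.Run (M.start, 0) w c ∧ c.1 ∈ M.accept}

/-- The automaton is one-turn: in no computation from the start configuration is a decrease of
the counter followed, immediately or later, by an increase. -/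
def OneTurn (M : OneCounter α σ) : Prop :=
  ∀ (u v : List α) (x y : Option α) (c₁ c₂ c₃ c₄ : σ × ℕ),
    M.Run (M.start, 0) u c₁ → M.Step c₁ x c₂ → c₂.2 < c₁.2 →
      M.Run c₂ v c₃ → M.Step c₃ y c₄ → c₄.2 ≤ c₃.2

end OneCounter

/-- `L` is accepted by a deterministic one-turn one-counter automaton with finitely many states. -/
def IsDetLinearOneCounter {α : Type} (L : Language α) : Prop :=
  ∃ (σ : Type) (_ : Finite σ) (M : OneCounter α σ), M.OneTurn ∧ M.language = L

/-! ### Unambiguous linear context-free grammars -/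

/-- A grammar is linear if every right-hand side contains at most one nonterminal. -/
def LinearGrammar {α : Type} (g : ContextFreeGrammar α) : Prop :=
  ∀ r ∈ g.rules,
    (∃ x : List α, r.output = x.map Symbol.terminal) ∨
    (∃ (x : List α) (n : g.NT) (y : List α),
      r.output = x.map Symbol.terminal ++ [Symbol.nonterminal n] ++ y.map Symbol.terminal)

/-- `LeftmostDerivation g rs u v`: applying successively the rules `rs` of `g`, always to the
leftmost nonterminal, leads from `u` to `v`. -/
inductive LeftmostDerivation {α : Type} (g : ContextFreeGrammar α) :
    List (ContextFreeRule α g.NT) → List (Symbol α g.NT) → List (Symbol α g.NT) → Prop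
  | refl (u) : LeftmostDerivation g [] u u
  | step {r rs} {x : List α} {y v : List (Symbol α g.NT)} : r ∈ g.rules →
      LeftmostDerivation g rs (x.map Symbol.terminal ++ r.output ++ y) v →
      LeftmostDerivation g (r :: rs)
        (x.map Symbol.terminal ++ [Symbol.nonterminal r.input] ++ y) v

/-- A grammar is unambiguous if every word has at most one leftmost derivation. -/
def UnambiguousGrammar {α : Type} (g : ContextFreeGrammar α) : Prop :=
  ∀ (w : List α) (rs rs' : List (ContextFreeRule α g.NT)),
    LeftmostDerivation g rs [Symbol.nonterminal g.initial] (w.map Symbol.terminal) →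
    LeftmostDerivation g rs' [Symbol.nonterminal g.initial] (w.map Symbol.terminal) →
    rs = rs'

/-- `L` is generated by an unambiguous linear context-free grammar. -/
def IsUnambiguousLinear {α : Type} (L : Language α) : Prop :=
  ∃ g : ContextFreeGrammar α, LinearGrammar g ∧ UnambiguousGrammar g ∧ g.language = L

/-! ### Logarithmic space -/

/-- The content of a cell of the input tape: a letter, or one of the two end markers. -/
inductive InputCell (α : Type)
  | leftEnd
  | letter (x : α)
  | rightEnd

/-- A movement of a head. -/
inductive HeadMove
  | left
  | stay
  | right

/-- The new position of a head; a left move on the leftmost cell `0` has no effect. -/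
def HeadMove.apply : HeadMove → ℕ → ℕ
  | .left, i => i - 1
  | .stay, i => i
  | .right, i => i + 1

/-- A deterministic Turing machine with a two-way read-only input tape and a one-way infinite
read-write work tape; `σ` are the states and `Γ` is the work alphabet. The machine halts if
`move` yields `none`. -/
structure WorkTapeMachine (α σ Γ : Type) where
  start : σ
  blank : Γ
  accept : Set σ
  move : σ → InputCell α → Γ → Option (σ × Γ × HeadMove × HeadMove)

/-- A configuration of a machine. -/
structure WorkTapeCfg (σ Γ : Type) where
  state : σ
  inputHead : ℕ
  workHead : ℕ
  work : ℕ → Γ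

namespace WorkTapeMachine

variable {α σ Γ : Type}

/-- The input tape: cell `0` holds the left end marker, the cells `1, …, n` hold the input, and
cell `n + 1` holds the right end marker. -/
def inputCell (w : List α) : ℕ → InputCell α
  | 0 => .leftEnd
  | i + 1 => match w[i]? with
    | some x => .letter x
    | none => .rightEnd

/-- The initial configuration. -/
def init (M : WorkTapeMachine α σ Γ) : WorkTapeCfg σ Γ := ⟨M.start, 0, 0, fun _ => M.blank⟩

/-- One step on the input `w`; `none` means that the machine has halted. The input head does
not move beyond the right end marker. -/
def step (M : WorkTapeMachine α σ Γ) (w : List α) (c : WorkTapeCfg σ Γ) :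
    Option (WorkTapeCfg σ Γ) :=
  (M.move c.state (inputCell w c.inputHead) (c.work c.workHead)).map fun r =>
    { state := r.1
      inputHead := min (r.2.2.1.apply c.inputHead) (w.length + 1)
      workHead := r.2.2.2.apply c.workHead
      work := Function.update c.work c.workHead r.2.1 }

/-- The configuration `c` occurs in the computation on the input `w`. -/
def Reaches (M : WorkTapeMachine α σ Γ) (w : List α) (c : WorkTapeCfg σ Γ) : Prop :=
  Relation.ReflTransGen (fun c d => M.step w c = some d) M.init c

/-- The machine halts on every input, and it halts in an accepting state exactly on the words
of `L`. -/
def Decides (M : WorkTapeMachine α σ Γ) (L : Language α) : Prop :=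
  ∀ w, ∃ c, M.Reaches w c ∧ M.step w c = none ∧ (c.state ∈ M.accept ↔ w ∈ L)

/-- On inputs of length `n` the machine visits only work cells with index less than
`C (⌊log₂ n⌋ + 1)`, for some constant `C`. -/
def UsesLogSpace (M : WorkTapeMachine α σ Γ) : Prop :=
  ∃ C : ℕ, ∀ w c, M.Reaches w c → c.workHead < C * (Nat.log 2 w.length + 1)

end WorkTapeMachine

/-- `L` is recognized in logarithmic space by a deterministic Turing machine. -/
def IsLogSpace {α : Type} (L : Language α) : Prop :=
  ∃ (σ Γ : Type) (_ : Finite σ) (_ : Finite Γ) (M : WorkTapeMachine α σ Γ),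
    M.Decides L ∧ M.UsesLogSpace

end BSol

namespace BSol

/-! ### Words and the length-lexicographical order -/

section Order

variable {p q : ℕ}

/-! Britton's lemma, taken from the HNN extension of `ℤ`, shows that a word for a power of `a` is
built from letters `a`, `A`, peaks `t x T` and valleys `T x t`, where `x` denotes a power of `a^p`
or of `a^q` respectively (`horo_of_eval_eq`). Since `p < q`, a geodesic contains no valley. A peak
denotes a power of `a`, so it commutes with powers of `a`; as `t` is the least letter, it moves to
the front in a normal form. Hence the normal form of a horocyclic element is `t^k u` with a slope
`u` containing `k` letters `T` (`Horo.exists_slopeWord`), and the normal form of an element denoted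
by a slope is a horocyclic word followed by blocks `T a^α` with `|α| < q` (`exists_of_llnf_eq`).

Two slopes denoting the same element differ by carries `T a^(qc) = a^(pc) T`. If their blocks are
bounded by `q`, the carries are bounded by `2q` (`exists_carry`), so cutting both at the same level
gives points at bounded distance. This fellow-traveller property feeds a Myhill–Nerode argument
(`isRegular_normalLang`): to recognise normality it suffices to know, for each short `h`, how the
word read so far compares with the normal form of its translate by `h`. This gives the first claim.
The argument also works after a fixed prefix `t^J`, provided that `t^J` makes the first `J + 1`
blocks horocyclic.

If `p ∣ q`, a slope becomes horocyclic after a power of `t` exactly when all blocks but the last are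
divisible by `p`, which is a regular condition; this gives the second claim. For the third, let `k`
be the number of letters `T` in `u`. With `r = q / p ≥ 2`, each peak multiplies an exponent by `r`,
so a competitor of `t^k u` with far fewer letters `t` would need too large an initial power of `a`.
Therefore normality of `t^J u` for one constant `J` implies that of `t^k u`
(`mem_coreLang_of_mem_normalLang`), and the set of these `u` is regular.

The horocyclic normal forms are thus the words `t^k u` with `u` accepted by a finite automaton and
`k` counting the letters `T` of `u`. A one-turn counter, a linear grammar deriving from the outside
inwards, and a binary counter on a work tape recognise such a language; giving `T` weight 2 and the
other letters weight 1, the transfer matrix of the automaton shows that the growth series is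
rational. -/

instance : Finite Letter :=
  Finite.of_surjective (![Letter.t, Letter.T, Letter.a, Letter.A] : Fin 4 → Letter) (by
    rintro (_ | _ | _ | _)
    exacts [⟨0, rfl⟩, ⟨1, rfl⟩, ⟨2, rfl⟩, ⟨3, rfl⟩])

instance : Std.Irrefl Letter.Before := ⟨fun x => lt_irrefl x.rank⟩

instance : Std.Trichotomous Letter.Before := ⟨by
  rintro (_ | _ | _ | _) (_ | _ | _ | _) <;> simp [Letter.Before, Letter.rank]⟩

/-- The length-lexicographical order. -/
abbrev SLex (v w : List Letter) : Prop := List.Shortlex Letter.Before v w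

theorem sLex_append_left_iff (x v w : List Letter) : SLex (x ++ v) (x ++ w) ↔ SLex v w := by
  induction x with
  | nil => rfl
  | cons c x ih => rw [List.cons_append, List.cons_append, SLex, List.shortlex_cons_iff]; exact ih

theorem sLex_cons_of_before {b d : Letter} {v w : List Letter} (h : v.length = w.length)
    (hbd : b.Before d) : SLex (b :: v) (d :: w) :=
  List.Shortlex.of_lex (by simp [h]) (List.Lex.rel hbd)

theorem sLex_cons_of_ne {b d : Letter} {v w : List Letter} (hbd : b ≠ d) :
    SLex (b :: v) (d :: w) ↔ v.length < w.length ∨ v.length = w.length ∧ b.Before d := by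
  rw [SLex, List.shortlex_def]
  simp only [List.length_cons, add_lt_add_iff_right, add_left_inj]
  refine or_congr Iff.rfl (and_congr_right fun _ => ⟨fun h => ?_, List.Lex.rel⟩)
  cases h with
  | cons h => exact absurd rfl hbd
  | rel h => exact h

theorem sLex_append_right {v w : List Letter} (hvw : SLex v w) (y : List Letter) :
    SLex (v ++ y) (w ++ y) := by
  rcases List.shortlex_def.1 hvw with h | ⟨h, h'⟩
  · exact List.Shortlex.of_length_lt (by simpa using h)
  · refine List.Shortlex.of_lex (by simp [h]) ?_
    clear hvw
    induction h' with
    | nil => simp at h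
    | cons _ ih => exact List.Lex.cons (ih (by simpa using h))
    | rel h' => exact List.Lex.rel h'

theorem sLex_length_le {v w : List Letter} (h : SLex v w) : v.length ≤ w.length := by
  rcases List.shortlex_def.1 h with h | ⟨h, -⟩ <;> omega

theorem sLex_trichotomy (v w : List Letter) : SLex v w ∨ v = w ∨ SLex w v := by
  by_contra! h
  exact h.2.1 (Std.Trichotomous.trichotomous (r := List.Shortlex Letter.Before) v w h.1 h.2.2)

@[simp]
theorem eval_nil : eval p q [] = 1 := rfl

@[simp]
theorem eval_cons (x : Letter) (w : List Letter) :
    eval p q (x :: w) = letterVal p q x * eval p q w := by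
  simp [eval]

@[simp]
theorem eval_append (v w : List Letter) : eval p q (v ++ w) = eval p q v * eval p q w := by
  simp [eval]

@[simp]
theorem letterVal_t : letterVal p q .t = genT p q := rfl
@[simp]
theorem letterVal_T : letterVal p q .T = (genT p q)⁻¹ := rfl
@[simp]
theorem letterVal_a : letterVal p q .a = genA p q := rfl
@[simp]
theorem letterVal_A : letterVal p q .A = (genA p q)⁻¹ := rfl

@[simp]
theorem eval_replicate_t (k : ℕ) : eval p q (List.replicate k .t) = genT p q ^ k := by
  simp [eval]

@[simp]
theorem eval_powWord (n : ℤ) : eval p q (powWord n) = genA p q ^ n := by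
  unfold powWord
  split_ifs with h
  · simp only [eval, List.map_replicate, letterVal_a, List.prod_replicate]
    rw [← zpow_natCast, Int.natAbs_of_nonneg h]
  · simp only [eval, List.map_replicate, letterVal_A, List.prod_replicate]
    rw [← zpow_natCast, inv_zpow', Int.ofNat_natAbs_of_nonpos (by omega), neg_neg]

@[simp]
theorem length_powWord (n : ℤ) : (powWord n).length = n.natAbs := by
  unfold powWord
  split_ifs <;> simp

theorem eval_llnf (w : List Letter) : eval p q (llnf p q w) = eval p q w :=
  shortlex_wf.min_mem {v | eval p q v = eval p q w} ⟨w, rfl⟩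

theorem not_sLex_llnf {v w : List Letter} (h : eval p q v = eval p q w) :
    ¬ SLex v (llnf p q w) :=
  shortlex_wf.not_lt_min {v | eval p q v = eval p q w} h

theorem llnf_congr {v w : List Letter} (h : eval p q v = eval p q w) :
    llnf p q v = llnf p q w := by
  simp only [llnf, h]

theorem llnf_eq_iff {w : List Letter} :
    llnf p q w = w ↔ ∀ v, eval p q v = eval p q w → ¬ SLex v w := by
  refine ⟨fun h v hv => h ▸ not_sLex_llnf hv, fun h => ?_⟩
  rcases sLex_trichotomy (llnf p q w) w with h' | h' | h'
  · exact absurd h' (h _ (eval_llnf w))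
  · exact h'
  · exact absurd h' (not_sLex_llnf rfl)

theorem llnf_llnf (w : List Letter) : llnf p q (llnf p q w) = llnf p q w :=
  llnf_congr (eval_llnf w)

/-- The order is compatible with concatenation on both sides, so an earlier word for the infix would
yield an earlier word for the whole. -/
theorem llnf_eq_of_infix {x w y : List Letter} (h : llnf p q (x ++ w ++ y) = x ++ w ++ y) :
    llnf p q w = w := by
  rw [llnf_eq_iff] at h ⊢
  intro v hv hlt
  refine h (x ++ v ++ y) (by simp [hv]) (sLex_append_right ?_ y)
  exact (sLex_append_left_iff x v w).2 hlt

theorem llnf_eq_of_append_left {x w : List Letter} (h : llnf p q (x ++ w) = x ++ w) :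
    llnf p q w = w :=
  llnf_eq_of_infix (x := x) (y := []) (by simpa using h)

theorem llnf_eq_of_append_right {w y : List Letter} (h : llnf p q (w ++ y) = w ++ y) :
    llnf p q w = w :=
  llnf_eq_of_infix (x := []) (y := y) (by simpa using h)

/-- A word is geodesic if no shorter word denotes the same element. -/
def Geodesic (p q : ℕ) (w : List Letter) : Prop :=
  ∀ v, eval p q v = eval p q w → w.length ≤ v.length

theorem geodesic_of_llnf_eq {w : List Letter} (h : llnf p q w = w) : Geodesic p q w :=
  fun _ hv => not_lt.1 fun hlt => llnf_eq_iff.1 h _ hv (List.Shortlex.of_length_lt hlt)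

theorem Geodesic.of_infix {x w y : List Letter} (h : Geodesic p q (x ++ w ++ y)) :
    Geodesic p q w := by
  intro v hv
  have := h (x ++ v ++ y) (by simp [hv])
  simp only [List.length_append] at this
  omega

theorem Geodesic.of_append_left {x w : List Letter} (h : Geodesic p q (x ++ w)) :
    Geodesic p q w :=
  Geodesic.of_infix (x := x) (y := []) (by simpa using h)

theorem Geodesic.of_append_right {w y : List Letter} (h : Geodesic p q (w ++ y)) :
    Geodesic p q w :=
  Geodesic.of_infix (x := []) (y := y) (by simpa using h)

end Order

end BSol

namespace BSol

/-! ### Britton's lemma for Baumslag-Solitar groups -/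

section Britton

variable {p q : ℕ}

theorem genT_mul_pow (p q : ℕ) : genT p q * genA p q ^ p = genA p q ^ q * genT p q := by
  have h : PresentedGroup.mk ({FreeGroup.of Gen.t * FreeGroup.of Gen.a ^ p *
      (FreeGroup.of Gen.t)⁻¹ * (FreeGroup.of Gen.a ^ q)⁻¹} : Set (FreeGroup Gen))
      (FreeGroup.of Gen.t * FreeGroup.of Gen.a ^ p *
      (FreeGroup.of Gen.t)⁻¹ * (FreeGroup.of Gen.a ^ q)⁻¹) = 1 :=
    PresentedGroup.one_of_mem (Set.mem_singleton _)
  simp only [map_mul, map_inv, map_pow] at h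
  have h' : genT p q * genA p q ^ p * (genT p q)⁻¹ * (genA p q ^ q)⁻¹ = 1 := h
  rw [mul_inv_eq_one, mul_inv_eq_iff_eq_mul] at h'
  exact h'

theorem genT_conj_zpow (p q : ℕ) (m : ℤ) :
    genT p q * genA p q ^ (p * m : ℤ) * (genT p q)⁻¹ = genA p q ^ (q * m : ℤ) := by
  rw [zpow_mul, zpow_mul, ← conj_zpow, zpow_natCast, zpow_natCast, genT_mul_pow,
    mul_inv_cancel_right]

theorem genT_inv_conj_zpow (p q : ℕ) (m : ℤ) :
    (genT p q)⁻¹ * genA p q ^ (q * m : ℤ) * genT p q = genA p q ^ (p * m : ℤ) := by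
  rw [← genT_conj_zpow]
  group

theorem genT_inv_mul_zpow (p q : ℕ) (m : ℤ) :
    (genT p q)⁻¹ * genA p q ^ (q * m : ℤ) = genA p q ^ (p * m : ℤ) * (genT p q)⁻¹ := by
  rw [← genT_inv_conj_zpow]
  group

/-- The word problem of a horocyclic element: `Horo p q w n` is a derivation that `w` denotes
`a ^ n`, in which every `t` is matched with a `T`. -/
inductive Horo (p q : ℕ) : List Letter → ℤ → Prop
  | nil : Horo p q [] 0
  | a {w n} : Horo p q w n → Horo p q (.a :: w) (1 + n)
  | A {w n} : Horo p q w n → Horo p q (.A :: w) (-1 + n)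
  | peak {x w m n} : Horo p q x (p * m) → Horo p q w n →
      Horo p q (.t :: x ++ .T :: w) (q * m + n)
  | valley {x w m n} : Horo p q x (q * m) → Horo p q w n →
      Horo p q (.T :: x ++ .t :: w) (p * m + n)

theorem Horo.eval_eq {w : List Letter} {n : ℤ} (h : Horo p q w n) :
    eval p q w = genA p q ^ n := by
  induction h with
  | nil => simp
  | a _ ih => simp [ih, zpow_add]
  | A _ ih => simp [ih, zpow_add]
  | peak _ _ ih ih' => simp [ih, ih', zpow_add, ← genT_conj_zpow, mul_assoc]
  | valley _ _ ih ih' => simp [ih, ih', zpow_add, ← genT_inv_conj_zpow, mul_assoc]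

/-- The letter `t` or `T`, as prescribed by a sign. -/
def signLetter (u : ℤˣ) : Letter := if u = 1 then .t else .T

@[simp]
theorem letterVal_signLetter (u : ℤˣ) : letterVal p q (signLetter u) = genT p q ^ (u : ℤ) := by
  rcases Int.units_eq_one_or u with rfl | rfl <;> simp [signLetter]

/-- The index of the associated subgroup belonging to a sign. -/
def signIndex (p q : ℕ) (u : ℤˣ) : ℤ := if u = 1 then p else q

/-- A decomposition of a word as `h₀ t^{u₁} h₁ ⋯ t^{uₖ} hₖ` with horocyclic words `hᵢ`. -/
inductive Dec (p q : ℕ) : List Letter → ℤ → List (ℤˣ × ℤ) → Prop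
  | horo {w n} : Horo p q w n → Dec p q w n []
  | cons {w w' n n' u L} : Horo p q w n → Dec p q w' n' L →
      Dec p q (w ++ signLetter u :: w') n ((u, n') :: L)

/-- No cancellation is possible in a decomposition. -/
def ReducedSeq (p q : ℕ) (L : List (ℤˣ × ℤ)) : Prop :=
  L.IsChain fun x y => signIndex p q x.1 ∣ x.2 → x.1 = y.1

/-- The element denoted by a sequence of signs and exponents. -/
def seqVal (p q : ℕ) (L : List (ℤˣ × ℤ)) : BS p q :=
  (L.map fun x => genT p q ^ (x.1 : ℤ) * genA p q ^ x.2).prod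

theorem Dec.eval_eq {w : List Letter} {n : ℤ} {L : List (ℤˣ × ℤ)} (h : Dec p q w n L) :
    eval p q w = genA p q ^ n * seqVal p q L := by
  induction h with
  | horo h => simp [h.eval_eq, seqVal]
  | cons h _ ih => simp [h.eval_eq, ih, seqVal, mul_assoc]

theorem Dec.append_head {y w : List Letter} {k m : ℤ} {L : List (ℤˣ × ℤ)} (h : Dec p q w m L)
    (hy : ∀ x n, Horo p q x n → Horo p q (y ++ x) (k + n)) : Dec p q (y ++ w) (k + m) L := by
  cases h with
  | horo h => exact .horo (hy _ _ h)
  | cons h h' => rw [← List.append_assoc]; exact .cons (hy _ _ h) h'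

/-- Letters are prepended one at a time. A new `t` or `T` either keeps the sequence reduced, or
closes a peak or valley with the head of the sequence; that peak or valley is a power of `a` and is
absorbed into the leading horocyclic word. -/
theorem exists_dec (p q : ℕ) (w : List Letter) :
    ∃ n L, Dec p q w n L ∧ ReducedSeq p q L := by
  have step : ∀ u w, (∃ n L, Dec p q w n L ∧ ReducedSeq p q L) →
      ∃ n L, Dec p q (signLetter u :: w) n L ∧ ReducedSeq p q L := by
    rintro u w ⟨n, L, h, hL⟩
    by_cases hc : signIndex p q u ∣ n ∧ L.head?.map Prod.fst = some (-u)
    · obtain ⟨⟨m, rfl⟩, hc⟩ := hc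
      cases h with
      | horo h => simp at hc
      | @cons _ _ _ k v L h h' =>
        simp only [List.head?_cons, Option.map_some, Option.some.injEq] at hc
        subst hc
        refine ⟨signIndex p q (-u) * m + k, L, ?_, List.IsChain.tail hL⟩
        rw [← List.cons_append, List.append_cons]
        refine h'.append_head (k := signIndex p q (-u) * m) fun x k hx => ?_
        rcases Int.units_eq_one_or u with rfl | rfl
        · simpa [signLetter, signIndex] using Horo.peak h hx
        · simpa [signLetter, signIndex] using Horo.valley h hx
    · refine ⟨0, (u, n) :: L, Dec.cons .nil h, ?_⟩
      rw [ReducedSeq, List.isChain_cons]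
      refine ⟨fun y hy hd => ?_, hL⟩
      by_contra hne
      refine hc ⟨hd, ?_⟩
      rw [Option.mem_def.1 hy, Option.map_some]
      rcases Int.units_eq_one_or u with rfl | rfl <;>
        rcases Int.units_eq_one_or y.1 with h1 | h1 <;> simp_all
  induction w with
  | nil => exact ⟨0, [], .horo .nil, List.isChain_nil⟩
  | cons x w ih =>
    cases x with
    | t => exact step 1 w ih
    | T => exact step (-1) w ih
    | a =>
      obtain ⟨n, L, h, hL⟩ := ih
      exact ⟨1 + n, L, h.append_head (y := [.a]) fun x n hx => .a hx, hL⟩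
    | A =>
      obtain ⟨n, L, h, hL⟩ := ih
      exact ⟨-1 + n, L, h.append_head (y := [.A]) fun x n hx => .A hx, hL⟩

/-! ### The homomorphism to the HNN extension of `ℤ`. -/

theorem zpowGroupHom_int_injective {n : ℕ} (hn : 1 ≤ n) :
    Function.Injective (zpowGroupHom (n : ℤ) : Multiplicative ℤ →* Multiplicative ℤ) := by
  intro x y h
  have h' : (n : ℤ) * x.toAdd = n * y.toAdd := by simpa using congrArg Multiplicative.toAdd h
  exact Multiplicative.toAdd.injective (mul_left_cancel₀ (by omega) h')

/-- The isomorphism `⟨a^p⟩ ≃ ⟨a^q⟩` between the associated subgroups. -/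
noncomputable def associatedEquiv (hp : 1 ≤ p) (hq : 1 ≤ q) :
    (zpowGroupHom (p : ℤ) : Multiplicative ℤ →* Multiplicative ℤ).range ≃*
      (zpowGroupHom (q : ℤ) : Multiplicative ℤ →* Multiplicative ℤ).range :=
  (MonoidHom.ofInjective (zpowGroupHom_int_injective hp)).symm.trans
    (MonoidHom.ofInjective (zpowGroupHom_int_injective hq))

/-- The homomorphism from `BS(p, q)` to the corresponding HNN extension of the integers. -/
noncomputable def toHNN (hp : 1 ≤ p) (hq : 1 ≤ q) :
    BS p q →* HNNExtension (Multiplicative ℤ) _ _ (associatedEquiv hp hq) :=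
  PresentedGroup.toGroup (f := fun
    | .a => HNNExtension.of (Multiplicative.ofAdd 1)
    | .t => HNNExtension.t) (by
    rintro _ rfl
    simp only [map_mul, map_inv, map_pow, FreeGroup.lift_apply_of]
    have h := HNNExtension.t_mul_of (φ := associatedEquiv hp hq)
      (MonoidHom.ofInjective (zpowGroupHom_int_injective hp) (Multiplicative.ofAdd 1))
    have h' : ((associatedEquiv hp hq)
        (MonoidHom.ofInjective (zpowGroupHom_int_injective hp) (Multiplicative.ofAdd 1)) :
          Multiplicative ℤ) = Multiplicative.ofAdd 1 ^ q := by
      simp [associatedEquiv, MonoidHom.ofInjective_apply]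
    rw [h', MonoidHom.ofInjective_apply] at h
    rw [mul_inv_eq_one, mul_inv_eq_iff_eq_mul, ← map_pow]
    simpa [-ofAdd_nsmul] using h)

theorem toHNN_genA (hp : 1 ≤ p) (hq : 1 ≤ q) (n : ℤ) :
    toHNN hp hq (genA p q ^ n) = HNNExtension.of (Multiplicative.ofAdd n) := by
  rw [map_zpow]
  have : toHNN hp hq (genA p q) = HNNExtension.of (Multiplicative.ofAdd 1) :=
    PresentedGroup.toGroup.of _
  rw [this, ← map_zpow, ← ofAdd_zsmul]
  simp

theorem toHNN_genT (hp : 1 ≤ p) (hq : 1 ≤ q) :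
    toHNN hp hq (genT p q) = HNNExtension.t :=
  PresentedGroup.toGroup.of _

theorem genA_zpow_injective (hp : 1 ≤ p) (hq : 1 ≤ q) {m n : ℤ}
    (h : genA p q ^ m = genA p q ^ n) : m = n := by
  have h' := congrArg (toHNN hp hq) h
  rw [toHNN_genA, toHNN_genA] at h'
  exact Multiplicative.ofAdd.injective (HNNExtension.of_injective (associatedEquiv hp hq) h')

theorem mem_toSubgroup_iff (u : ℤˣ) (n : ℤ) :
    Multiplicative.ofAdd n ∈ HNNExtension.toSubgroup
      (zpowGroupHom (p : ℤ) : Multiplicative ℤ →* Multiplicative ℤ).range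
      (zpowGroupHom (q : ℤ) : Multiplicative ℤ →* Multiplicative ℤ).range u ↔
      signIndex p q u ∣ n := by
  have key (k : ℕ) : Multiplicative.ofAdd n ∈
      (zpowGroupHom (k : ℤ) : Multiplicative ℤ →* Multiplicative ℤ).range ↔ (k : ℤ) ∣ n := by
    constructor
    · rintro ⟨x, hx⟩
      exact ⟨x.toAdd, by simpa using (congrArg Multiplicative.toAdd hx).symm⟩
    · rintro ⟨m, rfl⟩
      exact ⟨Multiplicative.ofAdd m, by
        rw [zpowGroupHom_apply, ← ofAdd_zsmul, smul_eq_mul]⟩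
  rcases Int.units_eq_one_or u with rfl | rfl
  · simpa [signIndex] using key p
  · simpa [signIndex] using key q

/-- **Britton's lemma**, in the form of the uniqueness of reduced decompositions. -/
theorem britton (hp : 1 ≤ p) (hq : 1 ≤ q) {m n : ℤ} {K L : List (ℤˣ × ℤ)}
    (hK : ReducedSeq p q K) (hL : ReducedSeq p q L)
    (h : genA p q ^ m * seqVal p q K = genA p q ^ n * seqVal p q L) :
    K.map Prod.fst = L.map Prod.fst ∧
      ∀ u ∈ K.head?.map Prod.fst, signIndex p q (-u) ∣ n - m := by
  let W (n : ℤ) (L : List (ℤˣ × ℤ)) (hL : ReducedSeq p q L) :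
      HNNExtension.NormalWord.ReducedWord (Multiplicative ℤ)
        (zpowGroupHom (p : ℤ) : Multiplicative ℤ →* Multiplicative ℤ).range
        (zpowGroupHom (q : ℤ) : Multiplicative ℤ →* Multiplicative ℤ).range :=
    { head := Multiplicative.ofAdd n
      toList := L.map fun x => (x.1, Multiplicative.ofAdd x.2)
      chain := by
        rw [List.isChain_map]
        exact hL.imp fun x y hxy hx => hxy ((mem_toSubgroup_iff _ _).1 hx) }
  have hW (n : ℤ) (L : List (ℤˣ × ℤ)) (hL : ReducedSeq p q L) :
      (W n L hL).prod (associatedEquiv hp hq) =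
        toHNN hp hq (genA p q ^ n * seqVal p q L) := by
    rw [map_mul, toHNN_genA, seqVal, map_list_prod]
    simp only [W, HNNExtension.NormalWord.ReducedWord.prod, List.map_map]
    congr 3
    funext x
    simp [toHNN_genA, toHNN_genT, -map_zpow, map_zpow (toHNN hp hq) (genT p q)]
  have H := HNNExtension.ReducedWord.map_fst_eq_and_of_prod_eq (associatedEquiv hp hq)
    (w₁ := W m K hK) (w₂ := W n L hL)
    (by rw [hW m K hK, hW n L hL, h])
  simp only [W, List.map_map, List.head?_map, Option.map_map] at H
  refine ⟨H.1, fun u hu => ?_⟩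
  have := H.2 u hu
  rw [← ofAdd_neg, ← ofAdd_add, mem_toSubgroup_iff] at this
  rwa [show n - m = -m + n by ring]

/-- By Britton's lemma, a reduced decomposition of a word for `a ^ m` has no `t` or `T` left outside
its horocyclic part. -/
theorem horo_of_eval_eq (hp : 1 ≤ p) (hq : 1 ≤ q) {w : List Letter} {m : ℤ}
    (h : eval p q w = genA p q ^ m) : Horo p q w m := by
  obtain ⟨n, L, hd, hL⟩ := exists_dec p q w
  have hv := hd.eval_eq
  have hb := (britton hp hq (K := []) (m := m) (n := n) List.isChain_nil hL
    (by rw [← hv, h]; simp [seqVal])).1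
  cases L with
  | cons x L => simp at hb
  | nil =>
    cases hd with
    | horo hd =>
      rwa [genA_zpow_injective hp hq (h.symm.trans hd.eval_eq)]

/-- The word `T α₁ ⋯ T αₖ`. -/
def tailWord (l : List ℤ) : List Letter := l.flatMap fun α => .T :: powWord α

/-- The word `α₀ T α₁ ⋯ T αₖ`. -/
def slopeWord (n : ℤ) (l : List ℤ) : List Letter := powWord n ++ tailWord l

@[simp]
theorem tailWord_nil : tailWord [] = [] := rfl

@[simp]
theorem tailWord_cons (n : ℤ) (l : List ℤ) : tailWord (n :: l) = .T :: slopeWord n l := rfl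

@[simp]
theorem tailWord_append (k l : List ℤ) : tailWord (k ++ l) = tailWord k ++ tailWord l :=
  List.flatMap_append

theorem isSlope_iff {w : List Letter} : IsSlope w ↔ ∃ n l, w = slopeWord n l := Iff.rfl

theorem eval_slopeWord (n : ℤ) (l : List ℤ) :
    eval p q (slopeWord n l) = genA p q ^ n * eval p q (tailWord l) := by
  simp [slopeWord]

theorem eval_tailWord (l : List ℤ) :
    eval p q (tailWord l) = seqVal p q (l.map fun n => (-1, n)) := by
  induction l with
  | nil => rfl
  | cons n l ih => simp [eval_slopeWord, ih, seqVal, mul_assoc]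

theorem reducedSeq_tail (l : List ℤ) : ReducedSeq p q (l.map fun n => (-1, n)) := by
  rw [ReducedSeq, List.isChain_map, List.isChain_iff_getElem]
  simp

/-- A sequence with letters `T` only is automatically reduced, so Britton's lemma compares the two
slopes directly. The divisibility by `p` reflects `a^p T = T a^q`, the only way to move powers of
`a` across the first `T`. -/
theorem slope_eq_imp (hp : 1 ≤ p) (hq : 1 ≤ q) {m n : ℤ} {k l : List ℤ}
    (h : genA p q ^ m * eval p q (tailWord k) = genA p q ^ n * eval p q (tailWord l)) :
    k.length = l.length ∧ (k ≠ [] → (p : ℤ) ∣ n - m) := by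
  rw [eval_tailWord, eval_tailWord] at h
  have H := britton hp hq (reducedSeq_tail k) (reducedSeq_tail l) h
  refine ⟨by simpa using congrArg List.length H.1, fun hk => ?_⟩
  cases k with
  | nil => exact absurd rfl hk
  | cons x k => simpa [signIndex] using H.2 (-1) (by simp)

/-- A decomposition of a word as `h₀ T h₁ ⋯ T hₖ` with horocyclic words `hᵢ`. -/
inductive SlopeDec (p q : ℕ) : List Letter → ℤ → List ℤ → Prop
  | horo {w n} : Horo p q w n → SlopeDec p q w n []
  | cons {w w' n n' l} : Horo p q w n → SlopeDec p q w' n' l →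
      SlopeDec p q (w ++ .T :: w') n (n' :: l)

/-- The signs of a reduced decomposition are determined by the element, and those of a slope are all
negative. -/
theorem slopeDec_of_eval_eq (hp : 1 ≤ p) (hq : 1 ≤ q) {w : List Letter} {m : ℤ} {k : List ℤ}
    (h : eval p q w = genA p q ^ m * eval p q (tailWord k)) :
    ∃ n l, SlopeDec p q w n l := by
  obtain ⟨n, L, hd, hL⟩ := exists_dec p q w
  rw [hd.eval_eq, eval_tailWord] at h
  have H := (britton hp hq hL (reducedSeq_tail k) h).1
  refine ⟨n, L.map Prod.snd, ?_⟩
  have hall : ∀ x ∈ L, x.1 = -1 := by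
    intro x hx
    have := List.mem_map_of_mem (f := Prod.fst) hx
    rw [H] at this
    simp at this
    exact this.2
  clear H hL h
  induction hd with
  | horo h => exact .horo h
  | @cons w w' n n' u L h _ ih =>
    obtain rfl : u = -1 := hall (u, n') (by simp)
    exact .cons h (ih fun x hx => hall x (by simp [hx]))

end Britton

end BSol

namespace BSol

/-! ### The shape of geodesics and of normal forms -/

section Shape

variable {p q : ℕ}

/-- A word in the letters `a` and `A` only. -/
def IsPure (w : List Letter) : Prop := ∀ c ∈ w, c = .a ∨ c = .A

theorem isPure_cons {c : Letter} {w : List Letter} :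
    IsPure (c :: w) ↔ (c = .a ∨ c = .A) ∧ IsPure w := List.forall_mem_cons

theorem IsPure.exists_eval {w : List Letter} (hw : IsPure w) :
    ∃ n : ℤ, eval p q w = genA p q ^ n ∧ n.natAbs ≤ w.length ∧
      (w.length ≤ n.natAbs → w = powWord n) := by
  have key : ∃ i j : ℕ, eval p q w = genA p q ^ (i - j : ℤ) ∧ w.length = i + j ∧
      (j = 0 → w = List.replicate i .a) ∧ (i = 0 → w = List.replicate j .A) := by
    induction w with
    | nil => exact ⟨0, 0, by simp⟩
    | cons c w ih =>
      obtain ⟨hc, hw⟩ := isPure_cons.1 hw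
      obtain ⟨i, j, he, hl, hi, hj⟩ := ih hw
      rcases hc with rfl | rfl
      · refine ⟨i + 1, j, ?_, by simp only [List.length_cons]; omega, fun h => ?_, by simp⟩
        · rw [eval_cons, he, letterVal_a, ← zpow_one_add]
          congr 1
          push_cast
          ring
        · rw [hi h, List.replicate_succ]
      · refine ⟨i, j + 1, ?_, by simp only [List.length_cons]; omega, by simp, fun h => ?_⟩
        · rw [eval_cons, he, letterVal_A, ← zpow_neg_one (genA p q), ← zpow_add (genA p q)]
          congr 1
          push_cast
          ring
        · rw [hj h, List.replicate_succ]
  obtain ⟨i, j, he, hl, hi, hj⟩ := key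
  refine ⟨i - j, he, by omega, fun h => ?_⟩
  rcases Nat.eq_zero_or_pos j with rfl | h1
  · rw [hi rfl]
    simp [powWord]
  · obtain rfl : i = 0 := by omega
    rw [hj rfl, powWord, if_neg (by omega)]
    simp

/-- The cases are: no letter `t` or `T`, the first such letter opens a peak, or it opens a valley.
In the peak case the prefix is pure, which is what lets it be moved across the peak. -/
theorem Horo.cases_first {x : List Letter} {n : ℤ} (h : Horo p q x n) :
    IsPure x ∨
    (∃ y z w m j k, x = y ++ .t :: z ++ .T :: w ∧ IsPure y ∧ Horo p q y j ∧
      Horo p q z (p * m) ∧ Horo p q w k ∧ n = j + q * m + k) ∨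
    (∃ y z w m, x = y ++ (.T :: z ++ [.t]) ++ w ∧ Horo p q z (q * m)) := by
  induction h with
  | nil => exact Or.inl (by simp [IsPure])
  | @a w n _ ih =>
    rcases ih with ih | ⟨y, z, w, m, j, k, rfl, hy, hj, hz, hw, rfl⟩ | ⟨y, z, w, m, rfl, hz⟩
    · exact Or.inl (isPure_cons.2 ⟨Or.inl rfl, ih⟩)
    · exact Or.inr (Or.inl ⟨.a :: y, z, w, m, 1 + j, k, rfl, isPure_cons.2 ⟨Or.inl rfl, hy⟩,
        hj.a, hz, hw, by ring⟩)
    · exact Or.inr (Or.inr ⟨.a :: y, z, w, m, rfl, hz⟩)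
  | @A w n _ ih =>
    rcases ih with ih | ⟨y, z, w, m, j, k, rfl, hy, hj, hz, hw, rfl⟩ | ⟨y, z, w, m, rfl, hz⟩
    · exact Or.inl (isPure_cons.2 ⟨Or.inr rfl, ih⟩)
    · exact Or.inr (Or.inl ⟨.A :: y, z, w, m, -1 + j, k, rfl, isPure_cons.2 ⟨Or.inr rfl, hy⟩,
        hj.A, hz, hw, by ring⟩)
    · exact Or.inr (Or.inr ⟨.A :: y, z, w, m, rfl, hz⟩)
  | @peak x w m n hx hw =>
    exact Or.inr (Or.inl ⟨[], x, w, m, 0, n, rfl, by simp [IsPure], .nil, hx, hw, by ring⟩)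
  | @valley x w m n hx hw =>
    exact Or.inr (Or.inr ⟨[], x, w, m, by simp, hx⟩)

theorem horo_powWord (hp : 1 ≤ p) (hq : 1 ≤ q) (n : ℤ) : Horo p q (powWord n) n :=
  horo_of_eval_eq hp hq (eval_powWord n)

/-- A pure inside is shortened by `T a^(qm) t = a^(pm)`, which saves at least the two outer letters.
An inside beginning with a peak lets `T` cancel with the `t` of that peak, and an inner valley is
handled by recursion on the length. -/
theorem not_geodesic_valley (hp : 1 ≤ p) (hpq : p < q) {x : List Letter} {m : ℤ}
    (h : Horo p q x (q * m)) : ¬ Geodesic p q (.T :: x ++ [.t]) := by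
  intro hg
  rcases h.cases_first with hx | ⟨y, z, w, m', j, k, rfl, hy, hj, hz, hw, e⟩ |
    ⟨y, z, w, m', rfl, hz⟩
  · obtain ⟨n, he, hn, -⟩ := hx.exists_eval (p := p) (q := q)
    obtain rfl := genA_zpow_injective hp (by omega) (he.symm.trans h.eval_eq)
    have := hg (powWord (p * m)) (by simp [he, ← genT_inv_conj_zpow, mul_assoc])
    simp only [length_powWord, List.length_append, List.length_cons, List.length_nil,
      Int.natAbs_mul, Int.natAbs_natCast] at this hn
    have := Nat.mul_le_mul_right m.natAbs hpq.le
    omega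
  -- The peak `t z T` commutes with `y`; moved in front of it, its `t` cancels with the preceding
  -- `T`, which saves two letters.
  · have := hg (z ++ .T :: y ++ w ++ [.t]) (by
      have e' : (j + k : ℤ) = q * (m - m') := by linarith
      simp only [eval_append, eval_cons, hz.eval_eq, hj.eval_eq, hw.eval_eq, letterVal_T,
        letterVal_t, eval_nil, mul_one]
      have h1 : genA p q ^ j * genT p q * genA p q ^ (p * m' : ℤ) * ((genT p q)⁻¹ *
          genA p q ^ k) = genA p q ^ (q * m : ℤ) := by
        calc _ = genA p q ^ j * (genT p q * genA p q ^ (p * m' : ℤ) * (genT p q)⁻¹) *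
            genA p q ^ k := by group
          _ = _ := by rw [genT_conj_zpow, ← zpow_add (genA p q), ← zpow_add (genA p q), e]
      have h2 : (genT p q)⁻¹ * (genA p q ^ j * genA p q ^ k) * genT p q =
          genA p q ^ (p * (m - m') : ℤ) := by
        rw [← zpow_add, e', genT_inv_conj_zpow]
      calc _ = genA p q ^ (p * m' : ℤ) * ((genT p q)⁻¹ * (genA p q ^ j * genA p q ^ k) *
            genT p q) := by group
        _ = (genT p q)⁻¹ * genA p q ^ (q * m : ℤ) * genT p q := by
          rw [h2, genT_inv_conj_zpow, ← zpow_add]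
          congr 1
          ring
        _ = _ := by rw [← h1]; group)
    simp only [List.length_append, List.length_cons, List.length_nil] at this
    omega
  · refine not_geodesic_valley hp hpq hz (Geodesic.of_infix (x := .T :: y) (y := w ++ [.t]) ?_)
    simpa using hg
termination_by x.length
decreasing_by all_goals (subst_vars; simp only [List.length_append, List.length_cons]; omega)

theorem Horo.eq_powWord (hp : 1 ≤ p) (hpq : p < q) {x : List Letter} {n : ℤ}
    (h : Horo p q x n) (hx : IsPure x) (hg : Geodesic p q x) : x = powWord n := by
  obtain ⟨k, he, hn, hk⟩ := hx.exists_eval (p := p) (q := q)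
  obtain rfl := genA_zpow_injective hp (by omega) (he.symm.trans h.eval_eq)
  refine hk ?_
  have := hg (powWord k) (by simp [he])
  rwa [length_powWord] at this

/-- The peak equals `a^(qm)`, hence commutes with `a^j`. -/
theorem genT_peak_comm (j k m : ℤ) : genA p q ^ j * (genT p q * (genA p q ^ (p * m : ℤ) *
    ((genT p q)⁻¹ * genA p q ^ k))) =
    genT p q * (genA p q ^ (p * m : ℤ) * ((genT p q)⁻¹ * (genA p q ^ j * genA p q ^ k))) := by
  have h := genT_conj_zpow p q m
  have : genA p q ^ j * (genT p q * genA p q ^ (p * m : ℤ) * (genT p q)⁻¹) =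
      genT p q * genA p q ^ (p * m : ℤ) * (genT p q)⁻¹ * genA p q ^ j := by
    rw [h, ← zpow_add, ← zpow_add, add_comm]
  calc _ = genA p q ^ j * (genT p q * genA p q ^ (p * m : ℤ) * (genT p q)⁻¹) *
        genA p q ^ k := by group
    _ = _ := by rw [this]; group

/-- After a `T`, a peak could be moved to the front to cancel `T t`, and a power `a^n` with `|n| ≥
q` could be shortened by pulling `a^(±q)` through `T`, where it becomes `a^(±p)`. -/
theorem Horo.eq_powWord_of_geodesic_cons (hp : 1 ≤ p) (hpq : p < q) {x : List Letter} {n : ℤ}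
    (h : Horo p q x n) (hg : Geodesic p q (.T :: x)) : x = powWord n ∧ n.natAbs < q := by
  have hg' : Geodesic p q x := Geodesic.of_append_left (x := [.T]) hg
  have hx : IsPure x := by
    rcases h.cases_first with hx | ⟨y, z, w, m, j, k, rfl, hy, hj, hz, hw, -⟩ |
      ⟨y, z, w, m, rfl, hz⟩
    · exact hx
    · have := hg (z ++ .T :: y ++ w) (by
        simp only [List.cons_append, List.append_assoc, eval_append, eval_cons, hz.eval_eq,
          hj.eval_eq, hw.eval_eq, letterVal_T, letterVal_t, genT_peak_comm, inv_mul_cancel_left])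
      simp only [List.length_append, List.length_cons] at this
      omega
    · exact absurd (hg'.of_infix) (not_geodesic_valley hp hpq hz)
  have hxn := h.eq_powWord hp hpq hx hg'
  refine ⟨hxn, ?_⟩
  by_contra! hn
  obtain ⟨s, hs, hs'⟩ : ∃ s : ℤ, s.natAbs = 1 ∧ (n - q * s).natAbs + q = n.natAbs := by
    rcases le_total 0 n with h0 | h0
    · exact ⟨1, rfl, by omega⟩
    · exact ⟨-1, rfl, by omega⟩
  subst hxn
  have := hg (powWord (p * s) ++ .T :: powWord (n - q * s)) (by
    simp only [eval_append, eval_cons, eval_powWord, letterVal_T]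
    rw [← mul_assoc, ← genT_inv_mul_zpow, mul_assoc, ← zpow_add, add_sub_cancel])
  simp only [List.length_append, List.length_cons, length_powWord, Int.natAbs_mul,
    Int.natAbs_natCast, hs, mul_one] at this
  omega

/-- Only here does the order matter beyond the length: moving a peak in front of a nonempty power of
`a` keeps the length but puts `t`, the least letter, first. So a normal form that is not a power of
`a` starts with its peak; the inside is treated recursively, and what follows the closing `T` is a
power of `a`. -/
theorem Horo.exists_slopeWord (hp : 1 ≤ p) (hpq : p < q) {x : List Letter} {n : ℤ}
    (h : Horo p q x n) (hx : llnf p q x = x) :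
    ∃ k l, x = List.replicate l.length .t ++ slopeWord k l := by
  have hg := geodesic_of_llnf_eq hx
  rcases h.cases_first with h' | ⟨y, z, w, m, j, k, rfl, hy, hj, hz, hw, e⟩ |
      ⟨y, z, w, m, rfl, hz⟩
  · exact ⟨n, [], by simpa [slopeWord] using h.eq_powWord hp hpq h' hg⟩
  · cases y with
    | cons c y =>
      refine absurd ?_ (llnf_eq_iff.1 hx (.t :: (z ++ .T :: (c :: y) ++ w)) ?_)
      · simp only [List.cons_append, List.append_assoc]
        refine sLex_cons_of_before (by simp; omega) ?_
        rcases (isPure_cons.1 hy).1 with rfl | rfl <;> simp [Letter.Before, Letter.rank]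
      · have h1 := hj.eval_eq
        rw [eval_cons] at h1
        have h2 := genT_peak_comm (p := p) (q := q) j k m
        simp only [List.cons_append, List.append_assoc, eval_append, eval_cons, hz.eval_eq,
          hw.eval_eq, letterVal_t, letterVal_T]
        rw [← h1] at h2
        simp only [mul_assoc] at h2 ⊢
        exact h2.symm
    | nil =>
      simp only [List.nil_append] at hx hg ⊢
      have hz' : llnf p q z = z := llnf_eq_of_infix (x := [.t]) (y := .T :: w) (by simpa using hx)
      obtain ⟨k₀, l, hzl⟩ := hz.exists_slopeWord hp hpq hz'
      have hw' := (hw.eq_powWord_of_geodesic_cons hp hpq hg.of_append_left).1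
      refine ⟨k₀, l ++ [k], ?_⟩
      rw [hzl, hw']
      simp [slopeWord, List.replicate_succ]
  · exact absurd (hg.of_infix) (not_geodesic_valley hp hpq hz)
termination_by x.length
decreasing_by all_goals (subst_vars; simp only [List.length_append, List.length_cons]; omega)

theorem SlopeDec.eq_slopeWord (hp : 1 ≤ p) (hpq : p < q) {w : List Letter} {n : ℤ} {l : List ℤ}
    (h : SlopeDec p q w n l) (hg : Geodesic p q (.T :: w)) :
    w = slopeWord n l ∧ ∀ k ∈ n :: l, k.natAbs < q := by
  induction h with
  | horo h => simpa [slopeWord] using h.eq_powWord_of_geodesic_cons hp hpq hg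
  | @cons w w' n n' l h _ ih =>
    rw [← List.cons_append] at hg
    obtain ⟨h1, h2⟩ := h.eq_powWord_of_geodesic_cons hp hpq hg.of_append_right
    obtain ⟨h3, h4⟩ := ih hg.of_append_left
    refine ⟨by rw [h1, h3]; rfl, ?_⟩
    rw [List.forall_mem_cons]
    exact ⟨h2, h4⟩

theorem SlopeDec.exists_horo (hp : 1 ≤ p) (hpq : p < q) {w : List Letter} {n : ℤ} {l : List ℤ}
    (h : SlopeDec p q w n l) (hg : Geodesic p q w) :
    (∀ k ∈ l, k.natAbs < q) ∧ ∃ x, w = x ++ tailWord l ∧ Horo p q x n := by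
  cases h with
  | horo h => exact ⟨by simp, w, by simp, h⟩
  | cons h h' =>
    obtain ⟨h1, h2⟩ := h'.eq_slopeWord hp hpq hg.of_append_left
    exact ⟨h2, _, by rw [h1]; rfl, h⟩

theorem eval_horo_tailWord {x : List Letter} {n : ℤ} (h : Horo p q x n) (l : List ℤ) :
    eval p q (x ++ tailWord l) = genA p q ^ n * eval p q (tailWord l) := by
  rw [eval_append, h.eval_eq]

/-- The shape of the normal forms of the elements `a ^ m T α₁ ⋯ T αₖ`. -/
theorem exists_of_llnf_eq (hp : 1 ≤ p) (hpq : p < q) {v : List Letter} {m : ℤ} {k : List ℤ}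
    (hv : llnf p q v = v) (h : eval p q v = genA p q ^ m * eval p q (tailWord k)) :
    ∃ x n l, v = x ++ tailWord l ∧ Horo p q x n ∧ (∀ i ∈ l, i.natAbs < q) ∧
      l.length = k.length ∧
      genA p q ^ n * eval p q (tailWord l) = genA p q ^ m * eval p q (tailWord k) ∧
      ∃ s r, x = List.replicate r.length .t ++ slopeWord s r := by
  obtain ⟨n, l, hd⟩ := slopeDec_of_eval_eq hp (by omega) h
  obtain ⟨hl, x, rfl, hx⟩ := hd.exists_horo hp hpq (geodesic_of_llnf_eq hv)
  rw [eval_horo_tailWord hx] at h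
  exact ⟨x, n, l, rfl, hx, hl, (slope_eq_imp hp (by omega) h).1, h,
    hx.exists_slopeWord hp hpq (llnf_eq_of_append_right hv)⟩

/-! ### Bounds for the blocks of geodesics, and carries between equal slopes. -/

theorem mem_tailWord_split {l : List ℤ} {k : ℤ} (hk : k ∈ l) :
    ∃ x y, tailWord l = x ++ (.T :: powWord k) ++ y := by
  obtain ⟨l₁, l₂, rfl⟩ := List.append_of_mem hk
  exact ⟨tailWord l₁, tailWord l₂, by simp [slopeWord]⟩

theorem natAbs_lt_of_geodesic (hp : 1 ≤ p) (hpq : p < q) {x : List Letter} {l : List ℤ}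
    (hg : Geodesic p q (x ++ tailWord l)) {k : ℤ} (hk : k ∈ l) : k.natAbs < q := by
  obtain ⟨y, z, h⟩ := mem_tailWord_split hk
  have hg' := hg.of_append_left
  rw [h] at hg'
  exact ((horo_powWord hp (by omega) k).eq_powWord_of_geodesic_cons hp hpq hg'.of_infix).2

/-- From `p < q` follows `3p + 2 < 3q`, so `t a^(3p) T` is a shorter word for `a^(3q)`. -/
theorem natAbs_lt_of_geodesic_powWord (hpq : p < q) {n : ℤ}
    (hg : Geodesic p q (powWord n)) : n.natAbs < 3 * q := by
  by_contra! hn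
  obtain ⟨s, hs, hs'⟩ : ∃ s : ℤ, s.natAbs = 3 ∧ (n - q * s).natAbs + 3 * q = n.natAbs := by
    rcases le_total 0 n with h0 | h0
    · exact ⟨3, rfl, by omega⟩
    · exact ⟨-3, rfl, by omega⟩
  have := hg (.t :: powWord (p * s) ++ .T :: powWord (n - q * s)) (by
    simp only [eval_append, eval_cons, eval_powWord, letterVal_T, letterVal_t]
    rw [← mul_assoc, genT_conj_zpow, ← zpow_add, add_sub_cancel])
  simp only [List.length_append, List.length_cons, length_powWord, Int.natAbs_mul,
    Int.natAbs_natCast, hs] at this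
  omega

theorem eval_tailWord_carry (m c j : ℤ) (l : List ℤ) :
    genA p q ^ (m + p * c) * eval p q (tailWord (j :: l)) =
      genA p q ^ m * eval p q (tailWord ((q * c + j) :: l)) := by
  simp only [tailWord_cons, eval_cons, eval_slopeWord, letterVal_T, zpow_add, mul_assoc]
  rw [mul_right_inj, ← mul_assoc (genA p q ^ _) (genT p q)⁻¹, ← genT_inv_mul_zpow,
    mul_assoc (genT p q)⁻¹]

theorem eval_tailWord_cons_inj (m i j : ℤ) (k l : List ℤ) :
    genA p q ^ m * eval p q (tailWord (i :: k)) = genA p q ^ m * eval p q (tailWord (j :: l)) ↔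
      genA p q ^ i * eval p q (tailWord k) = genA p q ^ j * eval p q (tailWord l) := by
  simp only [tailWord_cons, eval_cons, eval_slopeWord, mul_right_inj]

/-- Carries between two slopes with bounded blocks are bounded. -/
theorem exists_carry (hp : 1 ≤ p) (hpq : p < q) {k l : List ℤ} {m n : ℤ}
    (hk : ∀ i ∈ k, i.natAbs ≤ q) (hl : ∀ i ∈ l, i.natAbs ≤ q)
    (h : genA p q ^ m * eval p q (tailWord k) = genA p q ^ n * eval p q (tailWord l)) :
    ∃ c : ℤ, n = m + p * c ∧ c.natAbs ≤ 2 * q := by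
  induction k generalizing m n l with
  | nil =>
    obtain rfl : l = [] := List.eq_nil_of_length_eq_zero
      (by simpa using (slope_eq_imp hp (by omega) h).1.symm)
    simp only [tailWord_nil, eval_nil, mul_one] at h
    exact ⟨0, by simp [genA_zpow_injective hp (by omega) h], by simp⟩
  | cons i k ih =>
    obtain ⟨hlen, hd⟩ := slope_eq_imp hp (by omega) h
    obtain ⟨c, hc⟩ := hd (by simp)
    obtain rfl : n = m + p * c := by omega
    cases l with
    | nil => simp at hlen
    | cons j l =>
      simp only [List.forall_mem_cons] at hk hl
      obtain ⟨c', hc', hb⟩ := ih (m := i) (n := q * c + j) hk.2 hl.2 (by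
        rwa [eval_tailWord_carry, eval_tailWord_cons_inj] at h)
      refine ⟨c, rfl, ?_⟩
      have h1 : (q : ℤ) * c = i - j + p * c' := by linarith
      -- The bound `2q` reproduces itself: with `|c'| ≤ 2q` and `p ≤ q - 1` the right-hand side is
      -- at most `2q²`.
      have h2 : q * c.natAbs ≤ 2 * q + p * c'.natAbs := by
        have := congrArg Int.natAbs h1
        rw [Int.natAbs_mul, Int.natAbs_natCast] at this
        rw [this]
        have h3 := Int.natAbs_add_le (i - j) (p * c')
        have h4 := Int.natAbs_sub_le i j
        rw [Int.natAbs_mul, Int.natAbs_natCast] at h3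
        omega
      have h5 : p * c'.natAbs ≤ (q - 1) * (2 * q) := Nat.mul_le_mul (by omega) hb
      have h6 : (q - 1) * (2 * q) + 2 * q = q * (2 * q) := by
        obtain ⟨q', rfl⟩ : ∃ q', q = q' + 1 := ⟨q - 1, by omega⟩
        simp only [Nat.add_sub_cancel]
        ring
      exact Nat.le_of_mul_le_mul_left (by omega : q * c.natAbs ≤ q * (2 * q)) (by omega)

/-- Cutting two equal slopes at the same level gives points at bounded distance. -/
theorem exists_cut (hp : 1 ≤ p) (hpq : p < q) {k₁ k₂ l : List ℤ} {m n : ℤ}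
    (hk : ∀ i ∈ k₁ ++ k₂, i.natAbs ≤ q) (hl : ∀ i ∈ l, i.natAbs ≤ q)
    (h : genA p q ^ m * eval p q (tailWord (k₁ ++ k₂)) =
      genA p q ^ n * eval p q (tailWord l)) :
    ∃ l₁ l₂ c, l = l₁ ++ l₂ ∧ c.natAbs ≤ 2 * q ∧
      genA p q ^ m * eval p q (tailWord k₁) * genA p q ^ (p * c : ℤ) =
        genA p q ^ n * eval p q (tailWord l₁) := by
  induction k₁ generalizing m n l with
  | nil =>
    obtain ⟨c, rfl, hc⟩ := exists_carry hp hpq hk hl h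
    exact ⟨[], l, c, rfl, hc, by simp [zpow_add]⟩
  | cons i k₁ ih =>
    obtain ⟨hlen, hd⟩ := slope_eq_imp hp (by omega) h
    obtain ⟨c, hc⟩ := hd (by simp)
    obtain rfl : n = m + p * c := by omega
    cases l with
    | nil => simp at hlen
    | cons j l =>
      simp only [List.cons_append, List.forall_mem_cons] at hk hl
      obtain ⟨l₁, l₂, c', rfl, hc', h'⟩ := ih (m := i) (n := q * c + j) hk.2 hl.2 (by
        rwa [eval_tailWord_carry, List.cons_append, eval_tailWord_cons_inj] at h)
      refine ⟨j :: l₁, l₂, c', rfl, hc', ?_⟩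
      rw [eval_tailWord_carry, tailWord_cons, tailWord_cons, eval_cons, eval_cons, eval_slopeWord,
        eval_slopeWord, ← h']
      simp only [mul_assoc]

end Shape

end BSol

namespace BSol

/-! ### Regularity from a fellow-traveller property -/

section Regular

variable {p q : ℕ}

theorem finite_image_of_factor {α β γ : Type*} {s : Set α} {f : α → β} {g : α → γ}
    (hf : (f '' s).Finite) (h : ∀ x ∈ s, ∀ y ∈ s, f x = f y → g x = g y) : (g '' s).Finite := by
  rcases isEmpty_or_nonempty α with hα | hα
  · rw [Set.eq_empty_of_isEmpty s, Set.image_empty]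
    exact Set.finite_empty
  refine (hf.image fun y => g (Function.invFunOn f s y)).subset ?_
  rintro _ ⟨x, hx, rfl⟩
  refine ⟨f x, ⟨x, hx, rfl⟩, ?_⟩
  exact h _ (Function.invFunOn_mem ⟨x, hx, rfl⟩) _ hx (Function.invFunOn_eq ⟨x, hx, rfl⟩)

/-- The pairs of continuations `(y, x)` for which `v y` comes before `u x`. -/
def cmpSet (u v : List Letter) : Set (List Letter × List Letter) :=
  {z | SLex (v ++ z.1) (u ++ z.2)}

theorem cmpSet_append_left (c u v : List Letter) : cmpSet (c ++ u) (c ++ v) = cmpSet u v := by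
  ext z
  simp only [cmpSet, Set.mem_ofPred_eq, List.append_assoc, sLex_append_left_iff]

theorem exists_common_prefix (u v : List Letter) :
    ∃ c u' v', u = c ++ u' ∧ v = c ++ v' ∧
      (u' = [] ∨ v' = [] ∨ ∃ b d u'' v'', u' = b :: u'' ∧ v' = d :: v'' ∧ b ≠ d) := by
  induction u generalizing v with
  | nil => exact ⟨[], [], v, rfl, rfl, Or.inl rfl⟩
  | cons b u ih =>
    cases v with
    | nil => exact ⟨[], b :: u, [], rfl, rfl, Or.inr (Or.inl rfl)⟩
    | cons d v =>
      by_cases h : b = d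
      · subst h
        obtain ⟨c, u', v', rfl, rfl, h⟩ := ih v
        exact ⟨b :: c, u', v', rfl, rfl, h⟩
      · exact ⟨[], b :: u, d :: v, rfl, rfl, Or.inr (Or.inr ⟨b, d, u, v, rfl, rfl, h⟩)⟩

/-- A common prefix does not affect the comparison. Afterwards either one word is exhausted and the
other is short, or the first letters differ, and then only the difference of the lengths and the
order of these two letters matter. -/
theorem finite_cmpSet (B : ℕ) :
    {S | ∃ u v : List Letter, u.length ≤ v.length + B ∧ v.length ≤ u.length + B ∧
      cmpSet u v = S}.Finite := by
  have h1 : {l : List Letter | l.length ≤ B}.Finite := List.finite_length_le _ B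
  let G : ℕ × ℕ × Prop → Set (List Letter × List Letter) := fun c =>
    {z | c.1 + z.1.length < c.2.1 + z.2.length ∨ c.1 + z.1.length = c.2.1 + z.2.length ∧ c.2.2}
  refine (((h1.prod h1).image fun z => cmpSet z.1 z.2).union
    (((Set.finite_Iic B).prod ((Set.finite_Iic B).prod Set.finite_univ)).image G)).subset ?_
  rintro _ ⟨u, v, huv, hvu, rfl⟩
  obtain ⟨c, u, v, rfl, rfl, h⟩ := exists_common_prefix u v
  rw [cmpSet_append_left]
  simp only [List.length_append] at huv hvu
  have hl : u.length ≤ v.length + B ∧ v.length ≤ u.length + B := by omega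
  rcases h with rfl | rfl | ⟨b, d, u, v, rfl, rfl, hbd⟩
  · exact Or.inl ⟨([], v), ⟨by simp, by simpa using hl.2⟩, rfl⟩
  · exact Or.inl ⟨(u, []), ⟨by simpa using hl.1, by simp⟩, rfl⟩
  · simp only [List.length_cons] at hl
    refine Or.inr ⟨(v.length - min u.length v.length, u.length - min u.length v.length,
      d.Before b), ⟨?_, ?_, Set.mem_univ _⟩, ?_⟩
    · simp only [Set.mem_Iic]; omega
    · simp only [Set.mem_Iic]; omega
    · ext z
      simp only [G, cmpSet, Set.mem_ofPred_eq, List.cons_append, sLex_cons_of_ne hbd.symm,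
        List.length_append]
      refine or_congr (by omega) (and_congr (by omega) Iff.rfl)

theorem exists_inverse_word (h : List Letter) :
    ∃ h', eval p q h' = (eval p q h)⁻¹ ∧ h'.length = h.length := by
  induction h with
  | nil => exact ⟨[], by simp⟩
  | cons c h ih =>
    obtain ⟨h', h1, h2⟩ := ih
    obtain ⟨d, hd⟩ : ∃ d, letterVal p q d = (letterVal p q c)⁻¹ := by
      cases c
      exacts [⟨.T, rfl⟩, ⟨.t, by simp⟩, ⟨.A, rfl⟩, ⟨.a, by simp⟩]
    exact ⟨h' ++ [d], by simp [h1, hd], by simp [h2]⟩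

/-- The words of `P` that, after the word `z`, are in normal form. -/
def normalLang (p q : ℕ) (P : Language Letter) (z : List Letter) : Language Letter :=
  {w | w ∈ P ∧ llnf p q (z ++ w) = z ++ w}

theorem normalLang_prefix {P : Language Letter} (hpre : ∀ u x, u ++ x ∈ P → u ∈ P)
    {z u x : List Letter} (h : u ++ x ∈ normalLang p q P z) : u ∈ normalLang p q P z :=
  ⟨hpre u x h.1, llnf_eq_of_append_right (y := x) (by
    rw [List.append_assoc]
    exact h.2)⟩

/-- A Myhill–Nerode argument. The hypothesis `hft` is required only for one-letter extensions of
words already known to be normal: a failure of normality is detected at the first letter where it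
occurs, and the blocks are then still bounded. -/
theorem isRegular_normalLang {P : Language Letter} (hP : P.IsRegular)
    (hpre : ∀ u x, u ++ x ∈ P → u ∈ P) (z : List Letter) (B : ℕ)
    (hft : ∀ u x b, u ++ x ∈ normalLang p q P z → u ++ x ++ [b] ∈ P →
      ∃ v v' h, llnf p q (z ++ (u ++ x ++ [b])) = v ++ v' ∧
        eval p q v = eval p q (z ++ u ++ h) ∧ h.length ≤ B) :
    (normalLang p q P z).IsRegular := by
  set K := normalLang p q P z with hK
  have : Finite {h : List Letter // h.length ≤ B} := List.finite_length_le _ B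
  -- `τ u` records, for each short `h`, how `z u` compares with the normal form of `z u h` under all
  -- continuations. By `hlen` the two lengths differ by at most `B`, so there are only finitely many
  -- values.
  let τ (u : List Letter) (h : {h : List Letter // h.length ≤ B}) :=
    cmpSet (z ++ u) (llnf p q (z ++ u ++ h.1))
  have hlen : ∀ u ∈ K, ∀ h : {h : List Letter // h.length ≤ B},
      (z ++ u).length ≤ (llnf p q (z ++ u ++ h.1)).length + B ∧
      (llnf p q (z ++ u ++ h.1)).length ≤ (z ++ u).length + B := by
    rintro u hu ⟨h, hB⟩
    constructor
    · obtain ⟨h', h1, h2⟩ := exists_inverse_word (p := p) (q := q) h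
      have := geodesic_of_llnf_eq hu.2 (llnf p q (z ++ u ++ h) ++ h') (by
        rw [eval_append, eval_llnf, eval_append _ h, h1, mul_inv_cancel_right])
      rw [List.length_append (bs := h'), h2] at this
      exact this.trans (by simpa using hB)
    · have := geodesic_of_llnf_eq (llnf_llnf (p := p) (q := q) (z ++ u ++ h)) (z ++ u ++ h)
        (eval_llnf _).symm
      rw [List.length_append (bs := h)] at this
      exact this.trans (by simpa using hB)
  -- If `u₂ x b` fails to be normal at the letter `b`, its normal form passes through that of `z u₂
  -- h` for a short `h`. Equality of `τ` transports the comparison to `u₁`, where the same `h` and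
  -- the same continuation yield an earlier word for `z u₁ x b`.
  have hstep : ∀ u₁ ∈ K, ∀ u₂ ∈ K,
      (P.leftQuotient u₁, τ u₁) = (P.leftQuotient u₂, τ u₂) →
      ∀ x, u₁ ++ x ∈ K → u₂ ++ x ∈ K := by
    intro u₁ h₁ u₂ h₂ he x
    rw [Prod.mk.injEq] at he
    induction x using List.reverseRecOn with
    | nil => simpa using fun _ => h₂
    | append_singleton x b ih =>
      intro hx
      rw [← List.append_assoc] at hx
      have hx₂ := ih (normalLang_prefix hpre hx)
      have hP₂ : u₂ ++ x ++ [b] ∈ P := by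
        have : x ++ [b] ∈ P.leftQuotient u₁ := by
          rw [Language.mem_leftQuotient, ← List.append_assoc]
          exact hx.1
        rw [he.1, Language.mem_leftQuotient, ← List.append_assoc] at this
        exact this
      rw [← List.append_assoc]
      refine ⟨hP₂, ?_⟩
      by_contra hne
      obtain ⟨v, v', h, hv, hvh, hB⟩ := hft u₂ x b hx₂ hP₂
      have hnf : llnf p q (v ++ v') = v ++ v' := by rw [← hv, llnf_llnf]
      have hvl : v = llnf p q (z ++ u₂ ++ h) := by
        rw [← llnf_congr hvh, llnf_eq_of_append_right hnf]
      have hlt : SLex (v ++ v') (z ++ u₂ ++ (x ++ [b])) := by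
        rw [← hv]
        rcases sLex_trichotomy (llnf p q (z ++ (u₂ ++ x ++ [b]))) (z ++ (u₂ ++ x ++ [b]))
          with h' | h' | h'
        · simpa using h'
        · exact absurd h' hne
        · exact absurd h' (not_sLex_llnf rfl)
      have hmem : (v', x ++ [b]) ∈ τ u₂ ⟨h, hB⟩ := by
        rw [hvl] at hlt
        exact hlt
      rw [← he.2] at hmem
      have hmem' : SLex (llnf p q (z ++ u₁ ++ h) ++ v') (z ++ u₁ ++ (x ++ [b])) := hmem
      refine llnf_eq_iff.1 hx.2 _ ?_ (by simpa using hmem')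
      have e1 : eval p q h * eval p q v' = eval p q (x ++ [b]) := by
        have := eval_llnf (p := p) (q := q) (z ++ (u₂ ++ x ++ [b]))
        rw [hv, eval_append, hvh] at this
        simp only [eval_append, mul_assoc, mul_right_inj] at this
        simpa using this
      rw [eval_append, eval_llnf]
      simp only [eval_append, mul_assoc] at e1 ⊢
      rw [e1]
  have hfin : ((fun u => (P.leftQuotient u, τ u)) '' (K : Set (List Letter))).Finite := by
    refine ((hP.finite_range_leftQuotient).prod
      (Set.Finite.pi' fun _ => finite_cmpSet B)).subset ?_
    rintro _ ⟨u, hu, rfl⟩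
    refine ⟨⟨u, rfl⟩, fun h => ?_⟩
    exact ⟨_, _, (hlen u hu h).1, (hlen u hu h).2, rfl⟩
  have hfin' : (K.leftQuotient '' (K : Set (List Letter))).Finite := by
    refine finite_image_of_factor hfin fun u₁ h₁ u₂ h₂ he => ?_
    ext x
    exact ⟨hstep u₁ h₁ u₂ h₂ he x, hstep u₂ h₂ u₁ h₁ he.symm x⟩
  refine Language.IsRegular.of_finite_range_leftQuotient
    ((hfin'.union (Set.finite_singleton ⊥)).subset ?_)
  rintro _ ⟨u, rfl⟩
  by_cases hu : u ∈ K
  · exact Or.inl ⟨u, hu, rfl⟩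
  · refine Or.inr ?_
    rw [Set.mem_singleton_iff, eq_bot_iff]
    exact fun x hx => hu (normalLang_prefix hpre hx)

theorem isRegular_of_finite {L : Language Letter} (hL : (L : Set (List Letter)).Finite) :
    L.IsRegular := by
  refine Language.IsRegular.of_finite_range_leftQuotient ?_
  obtain ⟨B, hB⟩ : ∃ B, ∀ w ∈ L, w.length ≤ B := by
    obtain ⟨B, hB⟩ := (hL.image List.length).bddAbove
    exact ⟨B, fun w hw => hB ⟨w, hw, rfl⟩⟩
  refine (((List.finite_length_le Letter B).image L.leftQuotient).union
    (Set.finite_singleton ⊥)).subset ?_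
  rintro _ ⟨u, rfl⟩
  by_cases hu : u.length ≤ B
  · exact Or.inl ⟨u, hu, rfl⟩
  · refine Or.inr ?_
    rw [Set.mem_singleton_iff, eq_bot_iff]
    intro x hx
    have := hB _ hx
    rw [List.length_append] at this
    omega

end Regular

end BSol

namespace BSol

/-! ### Slopes as a regular language -/

section Slopes

variable {p q : ℕ}

theorem powWord_zero : powWord 0 = [] := rfl

theorem powWord_concat_a {n : ℤ} (h : 0 ≤ n) : powWord n ++ [.a] = powWord (n + 1) := by
  rw [powWord, powWord, if_pos h, if_pos (by omega), ← List.replicate_succ']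
  congr 1
  omega

theorem powWord_concat_A {n : ℤ} (h : n ≤ 0) : powWord n ++ [.A] = powWord (n - 1) := by
  rcases h.eq_or_lt with rfl | h
  · rfl
  rw [powWord, powWord, if_neg (by omega), if_neg (by omega), ← List.replicate_succ']
  congr 1
  omega

theorem cons_a_powWord {n : ℤ} (h : 0 ≤ n) : .a :: powWord n = powWord (n + 1) := by
  rw [powWord, powWord, if_pos h, if_pos (by omega), ← List.replicate_succ]
  congr 1
  omega

theorem cons_A_powWord {n : ℤ} (h : n ≤ 0) : .A :: powWord n = powWord (n - 1) := by
  rcases h.eq_or_lt with rfl | h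
  · rfl
  rw [powWord, powWord, if_neg (by omega), if_neg (by omega), ← List.replicate_succ]
  congr 1
  omega

theorem mem_powWord {n : ℤ} {c : Letter} (h : c ∈ powWord n) : c = .a ∨ c = .A := by
  unfold powWord at h
  split_ifs at h
  · exact Or.inl (List.eq_of_mem_replicate h)
  · exact Or.inr (List.eq_of_mem_replicate h)

theorem count_T_powWord (n : ℤ) : (powWord n).count .T = 0 :=
  List.count_eq_zero.2 fun h => by simpa using mem_powWord h

theorem count_T_tailWord (l : List ℤ) : (tailWord l).count .T = l.length := by
  induction l with
  | nil => rfl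
  | cons n l ih => simp [slopeWord, count_T_powWord, ih]

theorem count_T_slopeWord (n : ℤ) (l : List ℤ) : (slopeWord n l).count .T = l.length := by
  simp [slopeWord, count_T_powWord, count_T_tailWord]

theorem t_notMem_tailWord (l : List ℤ) : .t ∉ tailWord l := by
  intro h
  obtain ⟨n, -, hn⟩ := List.mem_flatMap.1 h
  rcases List.mem_cons.1 hn with h | h
  · simp at h
  · simpa using mem_powWord h

theorem t_notMem_slopeWord (n : ℤ) (l : List ℤ) : .t ∉ slopeWord n l := by
  intro h
  rcases List.mem_append.1 h with h | h
  · simpa using mem_powWord h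
  · exact t_notMem_tailWord l h

theorem powWord_injective : Function.Injective powWord := by
  intro m n h
  have hl := congrArg List.length h
  rw [length_powWord, length_powWord] at hl
  rcases Nat.eq_zero_or_pos m.natAbs with h0 | h0
  · omega
  unfold powWord at h
  split_ifs at h
  · omega
  · have := List.eq_of_mem_replicate (h ▸ List.mem_replicate.2 ⟨by omega, rfl⟩ :
      Letter.a ∈ List.replicate n.natAbs Letter.A)
    simp at this
  · have := List.eq_of_mem_replicate (h ▸ List.mem_replicate.2 ⟨by omega, rfl⟩ :
      Letter.A ∈ List.replicate n.natAbs Letter.a)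
    simp at this
  · omega

theorem takeWhile_slopeWord (n : ℤ) (l : List ℤ) :
    (slopeWord n l).takeWhile (fun c => c ≠ .T) = powWord n := by
  rw [slopeWord, List.takeWhile_append_of_pos]
  · cases l <;> simp
  · intro c hc
    rcases mem_powWord hc with rfl | rfl <;> rfl

theorem slopeWord_injective {m n : ℤ} {k l : List ℤ} (h : slopeWord m k = slopeWord n l) :
    m = n ∧ k = l := by
  induction k generalizing m n l with
  | nil =>
    obtain rfl := powWord_injective
      ((takeWhile_slopeWord m []).symm.trans ((congrArg _ h).trans (takeWhile_slopeWord n l)))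
    have := congrArg (List.count .T) h
    rw [count_T_slopeWord, count_T_slopeWord, List.length_nil] at this
    exact ⟨rfl, (List.eq_nil_of_length_eq_zero this.symm).symm⟩
  | cons i k ih =>
    obtain rfl := powWord_injective
      ((takeWhile_slopeWord m _).symm.trans ((congrArg _ h).trans (takeWhile_slopeWord n l)))
    refine ⟨rfl, ?_⟩
    have h' := List.append_cancel_left h
    cases l with
    | nil => simp at h'
    | cons j l =>
      obtain ⟨rfl, rfl⟩ := ih (List.cons.inj h').2
      rfl

theorem isSlope_of_cons {c : Letter} {w : List Letter} (h : IsSlope (c :: w)) : IsSlope w := by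
  obtain ⟨n, l, h⟩ := isSlope_iff.1 h
  rcases lt_trichotomy n 0 with hn | rfl | hn
  · rw [slopeWord, show n = n + 1 - 1 by ring, ← cons_A_powWord (by omega),
      List.cons_append] at h
    exact ⟨n + 1, l, (List.cons.inj h).2⟩
  · cases l with
    | nil => simp [slopeWord, powWord_zero] at h
    | cons k l => exact ⟨k, l, (List.cons.inj h).2⟩
  · rw [slopeWord, show n = n - 1 + 1 by ring, ← cons_a_powWord (by omega),
      List.cons_append] at h
    exact ⟨n - 1, l, (List.cons.inj h).2⟩

theorem isSlope_of_append {v w : List Letter} (h : IsSlope (v ++ w)) : IsSlope w := by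
  induction v with
  | nil => exact h
  | cons c v ih => exact ih (isSlope_of_cons h)

/-- The slopes in which all blocks except the last one are divisible by `d`. -/
def divSlope (d : ℕ) : Language Letter :=
  {w | ∃ n l, w = slopeWord n l ∧ ∀ k ∈ (n :: l).dropLast, (d : ℤ) ∣ k}

theorem slopeWord_mem_divSlope {d : ℕ} {n : ℤ} {l : List ℤ} :
    slopeWord n l ∈ divSlope d ↔ ∀ k ∈ (n :: l).dropLast, (d : ℤ) ∣ k := by
  refine ⟨?_, fun h => ⟨n, l, rfl, h⟩⟩
  rintro ⟨n', l', h, hd⟩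
  obtain ⟨rfl, rfl⟩ := slopeWord_injective h
  exact hd

/-- The word `α₁ T ⋯ αₖ T`. -/
def initWord (l : List ℤ) : List Letter := l.flatMap fun α => powWord α ++ [.T]

theorem initWord_cons_append (n k : ℤ) (l : List ℤ) :
    initWord (n :: l) ++ powWord k = slopeWord n (l ++ [k]) := by
  induction l generalizing n with
  | nil => simp [initWord, slopeWord]
  | cons m l ih =>
    have h := ih m
    simp only [initWord, slopeWord, List.flatMap_cons, List.append_assoc, List.cons_append,
      List.nil_append, tailWord_cons] at h ⊢
    rw [h]

theorem mem_divSlope_iff {d : ℕ} {w : List Letter} :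
    w ∈ divSlope d ↔ ∃ l k, w = initWord l ++ powWord k ∧ ∀ i ∈ l, (d : ℤ) ∣ i := by
  constructor
  · rintro ⟨n, l, rfl, h⟩
    rcases List.eq_nil_or_concat l with rfl | ⟨l, k, rfl⟩
    · exact ⟨[], n, by simp [slopeWord, initWord], by simp⟩
    · refine ⟨n :: l, k, by rw [initWord_cons_append, List.concat_eq_append], ?_⟩
      rwa [List.concat_eq_append, ← List.cons_append, List.dropLast_concat] at h
  · rintro ⟨l, k, rfl, h⟩
    cases l with
    | nil => exact ⟨k, [], by simp [slopeWord, initWord], by simp⟩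
    | cons n l =>
      refine ⟨n, l ++ [k], initWord_cons_append n k l, ?_⟩
      rwa [← List.cons_append, List.dropLast_concat]

/-- The transition function of an automaton for `divSlope d`; a state holds the sign and the
residue of the current block. -/
def slopeStep (d : ℕ) : Option (SignType × ZMod d) → Letter → Option (SignType × ZMod d)
  | some (s, r), .a => if s = -1 then none else some (1, r + 1)
  | some (s, r), .A => if s = 1 then none else some (-1, r - 1)
  | some (_, r), .T => if r = 0 then some (0, 0) else none
  | _, _ => none

/-- An automaton for `divSlope d`. -/
def slopeDFA (d : ℕ) : DFA Letter (Option (SignType × ZMod d)) where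
  step := slopeStep d
  start := some (0, 0)
  accept := {s | s ≠ none}

theorem slopeDFA_eval_of_eq_some {d : ℕ} {w : List Letter} {s : SignType} {r : ZMod d}
    (h : (slopeDFA d).eval w = some (s, r)) :
    ∃ l k, w = initWord l ++ powWord k ∧ (∀ i ∈ l, (d : ℤ) ∣ i) ∧ SignType.sign k = s ∧
      (k : ZMod d) = r := by
  induction w using List.reverseRecOn generalizing s r with
  | nil =>
    obtain ⟨rfl, rfl⟩ : 0 = s ∧ 0 = r := by simpa [slopeDFA] using h
    exact ⟨[], 0, rfl, by simp, by simp, by simp⟩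
  | append_singleton w c ih =>
    rw [DFA.eval_append_singleton] at h
    rcases hw : (slopeDFA d).eval w with _ | ⟨s', r'⟩
    · rw [hw] at h
      simp [slopeDFA, slopeStep] at h
    obtain ⟨l, k, rfl, hl, rfl, rfl⟩ := ih hw
    rw [hw] at h
    cases c with
    | t => simp [slopeDFA, slopeStep] at h
    | a =>
      simp only [slopeDFA, slopeStep, sign_eq_neg_one_iff, Option.ite_none_left_eq_some,
        Option.some.injEq, Prod.mk.injEq] at h
      obtain ⟨h1, rfl, rfl⟩ := h
      refine ⟨l, k + 1, by rw [List.append_assoc, powWord_concat_a (by omega)], hl, ?_, by simp⟩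
      exact sign_pos (by omega)
    | A =>
      simp only [slopeDFA, slopeStep, sign_eq_one_iff, Option.ite_none_left_eq_some,
        Option.some.injEq, Prod.mk.injEq] at h
      obtain ⟨h1, rfl, rfl⟩ := h
      refine ⟨l, k - 1, by rw [List.append_assoc, powWord_concat_A (by omega)], hl, ?_, by simp⟩
      exact sign_neg (by omega)
    | T =>
      simp only [slopeDFA, slopeStep, Option.ite_none_right_eq_some,
        Option.some.injEq, Prod.mk.injEq] at h
      obtain ⟨h1, rfl, rfl⟩ := h
      refine ⟨l ++ [k], 0, by simp [initWord, powWord_zero], ?_, by simp, by simp⟩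
      rw [List.forall_mem_append, List.forall_mem_singleton]
      exact ⟨hl, (ZMod.intCast_zmod_eq_zero_iff_dvd k d).1 h1⟩

theorem slopeDFA_evalFrom_powWord (d : ℕ) (k : ℤ) :
    (slopeDFA d).evalFrom (some (0, 0)) (powWord k) = some (SignType.sign k, (k : ZMod d)) := by
  induction k using Int.induction_on with
  | zero => simp [powWord_zero]
  | succ n ih =>
    rw [← powWord_concat_a (by omega), DFA.evalFrom_append_singleton, ih]
    simp only [slopeDFA, slopeStep, sign_eq_neg_one_iff]
    rw [if_neg (by omega), sign_pos (by omega)]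
    simp
  | pred n ih =>
    rw [← powWord_concat_A (by omega), DFA.evalFrom_append_singleton, ih]
    simp only [slopeDFA, slopeStep, sign_eq_one_iff]
    rw [if_neg (by omega), sign_neg (by omega)]
    simp

theorem slopeDFA_evalFrom_initWord (d : ℕ) (l : List ℤ) (hl : ∀ i ∈ l, (d : ℤ) ∣ i) :
    (slopeDFA d).evalFrom (some (0, 0)) (initWord l) = some (0, 0) := by
  induction l with
  | nil => rfl
  | cons n l ih =>
    rw [List.forall_mem_cons] at hl
    have h1 := (ZMod.intCast_zmod_eq_zero_iff_dvd n d).2 hl.1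
    have h2 : (slopeDFA d).step (some (SignType.sign n, (n : ZMod d))) .T = some (0, 0) := by
      simp [slopeDFA, slopeStep, h1]
    rw [initWord, List.flatMap_cons, DFA.evalFrom_of_append, DFA.evalFrom_append_singleton,
      slopeDFA_evalFrom_powWord, h2]
    exact ih hl.2

theorem slopeDFA_accepts (d : ℕ) : (slopeDFA d).accepts = divSlope d := by
  ext w
  rw [mem_divSlope_iff]
  constructor
  · intro h
    obtain ⟨⟨s, r⟩, hs⟩ := Option.ne_none_iff_exists'.1 (show (slopeDFA d).eval w ≠ none from h)
    obtain ⟨l, k, hw, hl, -⟩ := slopeDFA_eval_of_eq_some hs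
    exact ⟨l, k, hw, hl⟩
  · rintro ⟨l, k, rfl, hl⟩
    change (slopeDFA d).evalFrom (some (0, 0)) _ ≠ none
    rw [DFA.evalFrom_of_append, slopeDFA_evalFrom_initWord d l hl, slopeDFA_evalFrom_powWord]
    simp

theorem isRegular_divSlope {d : ℕ} (hd : 1 ≤ d) : (divSlope d).IsRegular := by
  have : NeZero d := ⟨by omega⟩
  exact ⟨_, inferInstance, slopeDFA d, slopeDFA_accepts d⟩

theorem divSlope_prefix {d : ℕ} {u x : List Letter} (h : u ++ x ∈ divSlope d) :
    u ∈ divSlope d := by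
  rw [← slopeDFA_accepts] at h ⊢
  have h' : (slopeDFA d).eval (u ++ x) ≠ none := h
  change (slopeDFA d).eval u ≠ none
  intro hu
  rw [DFA.eval, DFA.evalFrom_of_append] at h'
  rw [DFA.eval] at hu
  rw [hu] at h'
  refine h' ?_
  clear h h' hu
  induction x with
  | nil => rfl
  | cons c x ih => exact ih

theorem mem_divSlope_one {w : List Letter} : w ∈ divSlope 1 ↔ IsSlope w :=
  ⟨fun ⟨n, l, h, _⟩ => ⟨n, l, h⟩, fun ⟨n, l, h⟩ => ⟨n, l, h, by simp⟩⟩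

theorem isSlope_of_mem_divSlope {d : ℕ} {w : List Letter} (h : w ∈ divSlope d) : IsSlope w :=
  let ⟨n, l, h, _⟩ := h
  ⟨n, l, h⟩

/-! ### Length bounds and the fellow-traveller property of slopes. -/

theorem length_tailWord_le {l : List ℤ} {B : ℕ} (h : ∀ i ∈ l, i.natAbs ≤ B) :
    (tailWord l).length ≤ l.length * (B + 1) := by
  induction l with
  | nil => simp
  | cons n l ih =>
    rw [List.forall_mem_cons] at h
    have := ih h.2
    simp only [tailWord_cons, List.length_cons, slopeWord, List.length_append, length_powWord]
    rw [Nat.add_mul]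
    have := h.1
    omega

theorem length_le_tailWord (l : List ℤ) : l.length ≤ (tailWord l).length := by
  rw [← count_T_tailWord l]
  exact List.count_le_length

/-- Without its last letter, a block of size greater than `q` still has size at least `q`, and it
follows a `T` inside the geodesic `y`. -/
theorem natAbs_le_of_geodesic_concat (hp : 1 ≤ p) (hpq : p < q) {y z : List Letter} {b : Letter}
    {l : List ℤ} (hg : Geodesic p q y) (h : y ++ [b] = z ++ tailWord l) {i : ℤ} (hi : i ∈ l) :
    i.natAbs ≤ q := by
  by_contra! hq
  obtain ⟨s, r, hs⟩ := mem_tailWord_split hi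
  obtain ⟨j, c, hj, hc⟩ : ∃ j c, j.natAbs + 1 = i.natAbs ∧ powWord i = powWord j ++ [c] := by
    rcases le_total 0 i with h0 | h0
    · exact ⟨i - 1, .a, by omega, by rw [powWord_concat_a (by omega)]; congr 1; omega⟩
    · exact ⟨i + 1, .A, by omega, by rw [powWord_concat_A (by omega)]; congr 1; omega⟩
  obtain ⟨r', e, hr⟩ : ∃ r' e, c :: r = r' ++ [e] := by
    rcases List.eq_nil_or_concat (c :: r) with h | ⟨r', e, h⟩
    · simp at h
    · exact ⟨r', e, by rw [h, List.concat_eq_append]⟩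
  have hy : y ++ [b] = (z ++ s) ++ (.T :: powWord j) ++ r' ++ [e] := by
    rw [h, hs, hc]
    simp [← hr]
  have hy' := (List.append_inj' hy rfl).1
  rw [hy'] at hg
  have := ((horo_powWord hp (by omega) j).eq_powWord_of_geodesic_cons hp hpq hg.of_infix).2
  omega

/-- By `hJ`, the prefix `t^J` together with the first `J + 1` blocks is a power of `a` as soon as a
further `T` follows. From there on the word behaves like an ordinary slope, to which `exists_cut`
applies. -/
theorem isRegular_normalLang_divSlope (hp : 1 ≤ p) (hpq : p < q) {d J : ℕ} (hd : 1 ≤ d)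
    (hJ : ∀ n l, l.length = J → (∀ k ∈ (n :: l).dropLast, (d : ℤ) ∣ k) →
      ∃ N : ℤ, eval p q (List.replicate J .t ++ slopeWord n l) = genA p q ^ N) :
    (normalLang p q (divSlope d) (List.replicate J .t)).IsRegular := by
  -- The bound is the sum of those needed in the two cases below: `J + 3q + J(q + 1)` for the length
  -- of `t^J u` when `u` has at most `J` letters `T`, and `q + 1 + 2pq` for the word `a^(-i) t
  -- a^(pc)` otherwise.
  refine isRegular_normalLang (isRegular_divSlope hd) (fun _ _ => divSlope_prefix) _
    (J + 3 * q + J * (q + 1) + 2 * p * q + q + 1) fun u x b hux hw => ?_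
  have hu := normalLang_prefix (fun _ _ => divSlope_prefix) hux
  obtain ⟨n, l, rfl, hl⟩ := hu.1
  have hug := geodesic_of_llnf_eq hu.2
  have hg1 := natAbs_lt_of_geodesic_powWord hpq (Geodesic.of_append_right hug.of_append_left)
  have hg2 : ∀ i ∈ l, i.natAbs ≤ q := fun i hi =>
    (natAbs_lt_of_geodesic hp hpq hug.of_append_left hi).le
  -- If `u` has few letters `T`, then `t^J u` is itself bounded, and its inverse leads back to the
  -- empty prefix of the normal form.
  by_cases hlJ : l.length ≤ J
  · obtain ⟨h, h1, h2⟩ :=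
      exists_inverse_word (p := p) (q := q) (List.replicate J .t ++ slopeWord n l)
    refine ⟨[], _, h, (List.nil_append _).symm, by rw [eval_append _ h, h1]; simp, ?_⟩
    rw [h2]
    have h3 := length_tailWord_le hg2
    have h4 := Nat.mul_le_mul_right (q + 1) hlJ
    simp only [slopeWord, List.length_append, List.length_replicate, length_powWord]
    omega
  · obtain ⟨l₀, l₁, i, rfl, hl₀⟩ : ∃ l₀ l₁ i, l = (l₀ ++ l₁) ++ [i] ∧ l₀.length = J := by
      rcases List.eq_nil_or_concat l with rfl | ⟨l', i, rfl⟩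
      · simp at hlJ
      · refine ⟨l'.take J, l'.drop J, i, by simp, ?_⟩
        rw [List.concat_eq_append, List.length_append, List.length_singleton] at hlJ
        rw [List.length_take]
        omega
    have hi : i.natAbs ≤ q := hg2 i (by simp)
    rw [← List.cons_append, List.dropLast_concat] at hl
    obtain ⟨N, hN⟩ := hJ n l₀ hl₀ fun k hk => hl k (by
      rcases List.mem_cons.1 (List.mem_of_mem_dropLast hk) with rfl | hk
      · simp
      · simp [hk])
    obtain ⟨j, r, hr⟩ : ∃ j r, powWord i ++ x ++ [b] = slopeWord j r := by
      have h1 := isSlope_of_mem_divSlope hw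
      have h2 : slopeWord n (l₀ ++ l₁ ++ [i]) ++ x ++ [b] =
          (slopeWord n (l₀ ++ l₁) ++ [.T]) ++ (powWord i ++ x ++ [b]) := by
        simp [slopeWord]
      rw [h2] at h1
      exact isSlope_iff.1 (isSlope_of_append h1)
    have hwe : List.replicate J .t ++ (slopeWord n (l₀ ++ l₁ ++ [i]) ++ x ++ [b]) =
        (List.replicate J .t ++ slopeWord n l₀) ++ tailWord (l₁ ++ j :: r) := by
      rw [tailWord_append, tailWord_cons, ← hr]
      simp [slopeWord]
    have hev : eval p q (List.replicate J .t ++ (slopeWord n (l₀ ++ l₁ ++ [i]) ++ x ++ [b])) =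
        genA p q ^ N * eval p q (tailWord (l₁ ++ j :: r)) := by
      rw [hwe, eval_append, hN]
    obtain ⟨y, m, k, hv, hy, hk, -, he, -⟩ := exists_of_llnf_eq hp hpq
      (llnf_llnf (List.replicate J .t ++ (slopeWord n (l₀ ++ l₁ ++ [i]) ++ x ++ [b])))
      ((eval_llnf _).trans hev)
    -- Both slopes are cut just before the last `T` of `u`; undoing `T a^i` and adding the carry
    -- `a^(pc)` connects the two cut points.
    obtain ⟨k₁, k₂, c, rfl, hc, hcut⟩ := exists_cut hp hpq (fun i' hi' =>
      natAbs_le_of_geodesic_concat hp hpq (geodesic_of_llnf_eq hux.2) (b := b)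
        (by rw [← hwe]; simp) hi') (fun i hi => (hk i hi).le) he.symm
    refine ⟨y ++ tailWord k₁, tailWord k₂, powWord (-i) ++ .t :: powWord (p * c),
      by rw [hv]; simp, ?_, ?_⟩
    · rw [eval_horo_tailWord hy, ← hcut]
      have h1 : List.replicate J .t ++ slopeWord n (l₀ ++ l₁ ++ [i]) =
          (List.replicate J .t ++ slopeWord n l₀) ++ (tailWord l₁ ++ .T :: powWord i) := by
        simp [slopeWord]
      rw [h1, eval_append (_ ++ _) (_ ++ _), eval_append (_ ++ _) (_ ++ _), hN]
      simp only [eval_append, eval_cons, eval_powWord, letterVal_t, letterVal_T]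
      group
    · simp only [List.length_append, List.length_cons, length_powWord, Int.natAbs_mul,
        Int.natAbs_natCast, Int.natAbs_neg]
      have := Nat.mul_le_mul_left p hc
      have : p * (2 * q) = 2 * p * q := by ring
      omega

theorem isRegular_slopeLang (hp : 1 ≤ p) (hpq : p < q) : (slopeLang p q).IsRegular := by
  have h := isRegular_normalLang_divSlope hp hpq (d := 1) (J := 0) le_rfl (by
    rintro n l hl -
    obtain rfl := List.eq_nil_of_length_eq_zero hl
    exact ⟨n, by simp [slopeWord]⟩)
  convert h using 1
  ext w
  exact and_congr mem_divSlope_one.symm Iff.rfl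

end Slopes

end BSol

namespace BSol

/-! ### Horocyclic words -/

section Horocyclic

variable {p q : ℕ}

/-- The exponent of the horocyclic element `t^k α₀ T α₁ ⋯ T αₖ` if `p r = q`. -/
def slopeVal (r : ℤ) (n : ℤ) (l : List ℤ) : ℤ := l.foldl (fun N k => r * N + k) n

theorem slopeVal_concat (r n k : ℤ) (l : List ℤ) :
    slopeVal r n (l ++ [k]) = r * slopeVal r n l + k := by
  simp [slopeVal]

theorem dvd_slopeVal {d r n : ℤ} {l : List ℤ} (h : ∀ k ∈ n :: l, d ∣ k) :
    d ∣ slopeVal r n l := by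
  induction l using List.reverseRecOn with
  | nil => exact h n (by simp)
  | append_singleton l k ih =>
    rw [slopeVal_concat]
    exact dvd_add (dvd_mul_of_dvd_right (ih fun i hi => h i (by
      rw [← List.cons_append]
      exact List.mem_append_left _ hi)) _) (h k (by simp))

/-- Horner's scheme: `t a^N T = a^(rN)` whenever `p ∣ N`, and this divisibility persists because all
blocks but the last are divisible by `p`. -/
theorem eval_replicate_slopeWord {r : ℕ} (hr : q = p * r) {n : ℤ} {l : List ℤ}
    (h : ∀ k ∈ (n :: l).dropLast, (p : ℤ) ∣ k) :
    eval p q (List.replicate l.length .t ++ slopeWord n l) = genA p q ^ slopeVal r n l := by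
  induction l using List.reverseRecOn with
  | nil => simp [slopeWord, slopeVal]
  | append_singleton l k ih =>
    rw [← List.cons_append, List.dropLast_concat] at h
    obtain ⟨m, hm⟩ := dvd_slopeVal (r := r) h
    have ih := ih fun i hi => h i (List.mem_of_mem_dropLast hi)
    have e : List.replicate (l ++ [k]).length .t ++ slopeWord n (l ++ [k]) =
        .t :: ((List.replicate l.length .t ++ slopeWord n l) ++ .T :: powWord k) := by
      simp [slopeWord, List.replicate_succ]
    rw [e, eval_cons, eval_append, ih, slopeVal_concat, eval_cons, eval_powWord, hm,
      show (r : ℤ) * (p * m) = q * m by rw [hr]; push_cast; ring, zpow_add (genA p q),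
      ← genT_conj_zpow]
    simp [mul_assoc]

/-- The innermost peak must collapse, which forces `p ∣ n`. It then contributes `q m` to the next
block, a multiple of `p`, so the condition on that block is unchanged. -/
theorem dvd_of_horocyclic (hp : 1 ≤ p) {r : ℕ} (hr : q = p * r) (hq : 1 ≤ q) {n : ℤ} {l : List ℤ}
    {j : ℕ} (h : genT p q ^ j * eval p q (slopeWord n l) ∈ horocyclicSubgroup p q) :
    ∀ k ∈ (n :: l).dropLast, (p : ℤ) ∣ k := by
  induction l generalizing n j with
  | nil => simp
  | cons k l ih =>
    obtain ⟨N, hN⟩ := Subgroup.mem_zpowers_iff.1 h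
    have hn : j ≠ 0 ∧ (p : ℤ) ∣ n := by
      by_contra hc
      -- `L i` spells `t^(i+1) a^n T ⋯`; if `p ∤ n`, it is reduced and nonempty, so it cannot denote
      -- a power of `a`.
      let L : ℕ → List (ℤˣ × ℤ) := fun i =>
        List.replicate i (1, 0) ++ (1, n) :: (k :: l).map fun n => (-1, n)
      have hval : ∀ i, seqVal p q (L i) = genT p q ^ (i + 1) * eval p q (slopeWord n (k :: l)) := by
        intro i
        simp only [L, seqVal, List.map_append, List.map_replicate, List.prod_append,
          List.prod_replicate, List.map_cons, List.prod_cons, eval_slopeWord, eval_tailWord]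
        simp only [Units.val_one, zpow_one, zpow_zero, mul_one, pow_succ, mul_assoc]
      have hred : ¬ (p : ℤ) ∣ n → ∀ i, ReducedSeq p q (L i) := by
        intro hpn i
        have h1 : ReducedSeq p q ((1, n) :: (k :: l).map fun n => (-1, n)) := by
          refine List.isChain_cons.2 ⟨fun y _ hy => ?_, reducedSeq_tail _⟩
          simp only [signIndex, if_true] at hy
          exact absurd hy hpn
        induction i with
        | zero => exact h1
        | succ i ih =>
          refine List.isChain_cons.2 ⟨fun y hy _ => ?_, ih⟩
          cases i with
          | zero =>
            obtain rfl : (1, n) = y := by simpa using hy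
            rfl
          | succ i =>
            obtain rfl : (1, 0) = y := by simpa [List.replicate_succ] using hy
            rfl
      cases j with
      | zero =>
        have := (slope_eq_imp hp hq (m := N) (n := n) (k := []) (l := k :: l) (by
          rw [hN]
          simp [eval_slopeWord])).1
        simp at this
      | succ j =>
        have := (britton hp hq (K := []) (m := N) (n := 0) List.isChain_nil
          (hred (fun h => hc ⟨by simp, h⟩) j) (by
            rw [hN, hval]
            simp [seqVal])).1
        simp [L] at this
    obtain ⟨hj, m, rfl⟩ := hn
    obtain ⟨j, rfl⟩ := Nat.exists_eq_succ_of_ne_zero hj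
    have h' : genT p q ^ j * eval p q (slopeWord (q * m + k) l) ∈ horocyclicSubgroup p q := by
      convert h using 1
      rw [eval_slopeWord, eval_slopeWord, zpow_add (genA p q), ← genT_conj_zpow, pow_succ,
        tailWord_cons, eval_cons, eval_slopeWord]
      simp [mul_assoc]
    have ih' := ih h'
    cases l with
    | nil => simp
    | cons i l =>
      rw [List.dropLast_cons_cons, List.forall_mem_cons] at ih' ⊢
      refine ⟨dvd_mul_right _ _, ?_⟩
      rw [List.dropLast_cons_cons, List.forall_mem_cons]
      refine ⟨?_, ih'.2⟩
      have h1 : (p : ℤ) ∣ q * m := ⟨r * m, by rw [hr]; push_cast; ring⟩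
      exact (dvd_add_right h1).1 ih'.1

theorem horocyclic_replicate {r : ℕ} (hr : q = p * r) {n : ℤ} {l : List ℤ}
    (h : slopeWord n l ∈ divSlope p) :
    IsHorocyclic p q (List.replicate l.length .t ++ slopeWord n l) := by
  rw [IsHorocyclic, eval_replicate_slopeWord hr (slopeWord_mem_divSlope.1 h)]
  exact Subgroup.zpow_mem_zpowers _ _

theorem mem_divSlope_iff_isSemiHorocyclic (hp : 1 ≤ p) (hq : 1 ≤ q) (hd : p ∣ q)
    {w : List Letter} : w ∈ divSlope p ↔ IsSemiHorocyclic p q w := by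
  obtain ⟨r, hr⟩ := hd
  constructor
  · rintro ⟨n, l, rfl, h⟩
    exact ⟨⟨n, l, rfl⟩, l.length, horocyclic_replicate hr (slopeWord_mem_divSlope.2 h)⟩
  · rintro ⟨hs, j, h⟩
    obtain ⟨n, l, rfl⟩ := isSlope_iff.1 hs
    rw [IsHorocyclic, eval_append, eval_replicate_t] at h
    exact slopeWord_mem_divSlope.2 (dvd_of_horocyclic hp hr hq h)

theorem isRegular_normalLang_replicate (hp : 1 ≤ p) (hpq : p < q) (hd : p ∣ q) (J : ℕ) :
    (normalLang p q (divSlope p) (List.replicate J .t)).IsRegular := by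
  obtain ⟨r, hr⟩ := hd
  refine isRegular_normalLang_divSlope hp hpq hp ?_
  rintro n l rfl h
  exact ⟨_, eval_replicate_slopeWord hr h⟩

theorem isRegular_semiHorocyclicLang (hp : 1 ≤ p) (hpq : p < q) (hd : p ∣ q) :
    (semiHorocyclicLang p q).IsRegular := by
  convert isRegular_normalLang_replicate hp hpq hd 0 using 1
  ext w
  exact and_congr (mem_divSlope_iff_isSemiHorocyclic hp (by omega) hd).symm Iff.rfl

/-- The semi-horocyclic slopes `w` with `k` letters `T` for which `t^k w` is in normal form. -/
def coreLang (p q : ℕ) : Language Letter :=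
  {w | w ∈ divSlope p ∧ llnf p q (List.replicate (w.count .T) .t ++ w) =
    List.replicate (w.count .T) .t ++ w}

theorem replicate_t_append_assoc (i j : ℕ) (w : List Letter) :
    List.replicate i .t ++ (List.replicate j .t ++ w) = List.replicate (i + j) .t ++ w := by
  rw [← List.append_assoc, List.replicate_append_replicate]

theorem mem_horocyclicLang_iff (hp : 1 ≤ p) (hpq : p < q) (hd : p ∣ q) {w : List Letter} :
    w ∈ horocyclicLang p q ↔
      ∃ u ∈ coreLang p q, w = List.replicate (u.count .T) .t ++ u := by
  constructor
  · rintro ⟨hw, hnf⟩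
    obtain ⟨N, hN⟩ := Subgroup.mem_zpowers_iff.1 hw
    obtain ⟨n, l, rfl⟩ := (horo_of_eval_eq hp (by omega) hN.symm).exists_slopeWord hp hpq hnf
    refine ⟨slopeWord n l, ⟨?_, ?_⟩, ?_⟩
    · exact (mem_divSlope_iff_isSemiHorocyclic hp (by omega) hd).2 ⟨⟨n, l, rfl⟩, l.length, hw⟩
    · rw [count_T_slopeWord]
      exact hnf
    · rw [count_T_slopeWord]
  · rintro ⟨u, ⟨hu, hnf⟩, rfl⟩
    obtain ⟨r, hr⟩ := hd
    obtain ⟨n, l, rfl, -⟩ := id hu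
    refine ⟨?_, hnf⟩
    rw [count_T_slopeWord]
    exact horocyclic_replicate hr hu

/-- For slopes with many blocks, being in normal form after a fixed power of `t` suffices. -/
theorem mem_coreLang_of_mem_normalLang (hp : 1 ≤ p) (hpq : p < q) (hd : p ∣ q)
    {w : List Letter}
    (hw : w ∈ normalLang p q (divSlope p) (List.replicate (3 + q + p * (2 * q)) .t)) :
    w ∈ coreLang p q := by
  obtain ⟨r, hr⟩ := id hd
  set J := 3 + q + p * (2 * q) with hJ
  obtain ⟨n, l, rfl, hl⟩ := hw.1
  induction hN : l.length using Nat.strong_induction_on generalizing n l with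
  | _ N ih =>
  subst hN
  refine ⟨hw.1, ?_⟩
  rw [count_T_slopeWord]
  by_contra hne
  set V := List.replicate l.length .t ++ slopeWord n l with hV
  have heV : eval p q V = genA p q ^ slopeVal r n l := eval_replicate_slopeWord hr hl
  have hlt : SLex (llnf p q V) V := by
    rcases sLex_trichotomy (llnf p q V) V with h | h | h
    · exact h
    · exact absurd h hne
    · exact absurd h (not_sLex_llnf rfl)
  obtain ⟨n', l', hv⟩ := (horo_of_eval_eq hp (by omega)
    ((eval_llnf V).trans heV)).exists_slopeWord hp hpq (llnf_llnf V)
  have hvV := eval_llnf (p := p) (q := q) V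
  have hvg := geodesic_of_llnf_eq (llnf_llnf (p := p) (q := q) V)
  rw [hv] at hlt hvV hvg
  by_cases hjJ : l.length ≤ l'.length + J
  · -- the competitor can be compared with `t^j w` for some `j ≤ J`
    -- `i` letters `t` common to both words are cancelled; what remains of `V` is a suffix of `t^J
    -- w` and therefore normal.
    obtain ⟨i, j, hi, hj, hij⟩ : ∃ i j, l.length = i + j ∧ j ≤ J ∧ i ≤ l'.length :=
      ⟨l.length - min l.length J, min l.length J, by omega, by omega, by omega⟩
    obtain ⟨i', hi'⟩ := Nat.exists_eq_add_of_le hij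
    rw [hV, hi, hi', ← replicate_t_append_assoc, ← replicate_t_append_assoc,
      sLex_append_left_iff] at hlt
    rw [hV, hi, hi', ← replicate_t_append_assoc, ← replicate_t_append_assoc,
      eval_append, eval_append (List.replicate i Letter.t), mul_right_inj] at hvV
    obtain ⟨j', hj'⟩ := Nat.exists_eq_add_of_le' hj
    have hnf := hw.2
    rw [hj', ← replicate_t_append_assoc] at hnf
    exact llnf_eq_iff.1 (llnf_eq_of_append_left hnf) _ hvV hlt
  · -- otherwise the exponents grow too fast for the competitor to be as short
    obtain ⟨l₀, i, l₁, rfl, hl₁⟩ : ∃ l₀ i l₁, l = l₀ ++ [i] ++ l₁ ∧ l₁.length = l'.length := by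
      have h1 : l.drop (l.length - l'.length - 1) ≠ [] := by
        rw [Ne, List.drop_eq_nil_iff]
        omega
      obtain ⟨i, l₁, h2⟩ := List.exists_cons_of_ne_nil h1
      refine ⟨l.take (l.length - l'.length - 1), i, l₁, ?_, ?_⟩
      · rw [List.append_assoc, List.singleton_append, ← h2, List.take_append_drop]
      · have := congrArg List.length h2
        rw [List.length_drop, List.length_cons] at this
        omega
    have hwg := geodesic_of_llnf_eq (llnf_eq_of_append_left hw.2)
    have hb : ∀ k ∈ l₀ ++ [i] ++ l₁, k.natAbs ≤ q := fun k hk =>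
      (natAbs_lt_of_geodesic hp hpq (x := powWord n) hwg hk).le
    have hb' : ∀ k ∈ l', k.natAbs ≤ q := fun k hk =>
      (natAbs_lt_of_geodesic hp hpq (x := powWord n') hvg.of_append_left hk).le
    have hsplit : slopeWord n (l₀ ++ [i] ++ l₁) =
        slopeWord n l₀ ++ .T :: (powWord i ++ tailWord l₁) := by
      simp [slopeWord]
    have hpre : slopeWord n l₀ ∈ divSlope p := by
      have := hw.1
      rw [hsplit] at this
      exact divSlope_prefix this
    have hdl : ∀ k ∈ n :: l₀, (p : ℤ) ∣ k := by
      have := slopeWord_mem_divSlope.1 (divSlope_prefix (u := slopeWord n (l₀ ++ [i]))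
        (x := tailWord l₁) (by simpa [slopeWord] using hw.1))
      rwa [← List.cons_append, List.dropLast_concat] at this
    -- The upper part `u` of `w` has fewer letters `T`, so by induction `t^k u` with matching `k` is
    -- normal, hence geodesic. This bounds `|N|` below by the length of `t^k u`.
    have hl₀ : slopeWord n l₀ ∈ coreLang p q := by
      refine ih l₀.length (by simp) n l₀ (slopeWord_mem_divSlope.1 hpre) ⟨hpre, ?_⟩ rfl
      have := hw.2
      rw [hsplit, ← List.append_assoc] at this
      exact llnf_eq_of_append_right this
    set N := slopeVal r n l₀ with hN
    have heN : eval p q (List.replicate l₀.length .t ++ slopeWord n l₀) = genA p q ^ N :=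
      eval_replicate_slopeWord hr (slopeWord_mem_divSlope.1 hpre)
    have hgN : l₀.length + (slopeWord n l₀).length ≤ N.natAbs := by
      have := hl₀.2
      rw [count_T_slopeWord] at this
      simpa using geodesic_of_llnf_eq this (powWord N) (by rw [heN, eval_powWord])
    obtain ⟨M, hM⟩ := dvd_slopeVal (r := r) hdl
    -- `w' ~ t^j w`
    have hcmp : genA p q ^ (r * N + i) * eval p q (tailWord l₁) =
        genA p q ^ n' * eval p q (tailWord l') := by
      have e1 : V = List.replicate l'.length .t ++ (.t :: ((List.replicate l₀.length .t ++
          slopeWord n l₀) ++ .T :: (powWord i ++ tailWord l₁))) := by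
        have : (l₀ ++ [i] ++ l₁).length = l'.length + (1 + l₀.length) := by
          simp only [List.length_append, List.length_cons, List.length_nil]
          omega
        rw [hV, hsplit, this, ← replicate_t_append_assoc, ← replicate_t_append_assoc]
        simp
      rw [e1, eval_append, eval_append, mul_right_inj, eval_cons, eval_append _ (_ :: _), heN,
        eval_slopeWord] at hvV
      rw [hvV, hN, hM, show (r : ℤ) * (p * M) + i = q * M + i by rw [hr]; push_cast; ring,
        zpow_add (genA p q), ← genT_conj_zpow]
      simp [mul_assoc]
    obtain ⟨c, hc, hcb⟩ := exists_carry hp hpq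
      (fun k hk => hb k (List.mem_append_right _ hk)) hb' hcmp
    -- replacing the lower part of `w` by that of the competitor
    have hrep := hwg (slopeWord n l₀ ++ .T :: (powWord (i + p * c) ++ tailWord l')) (by
      rw [hsplit]
      have h1 : genA p q ^ i * eval p q (tailWord l₁) =
          genA p q ^ (i + p * c) * eval p q (tailWord l') := by
        rw [hc, add_assoc, zpow_add (genA p q) (r * N), zpow_add (genA p q) (r * N),
          mul_assoc (genA p q ^ _),
          mul_assoc (genA p q ^ _), mul_right_inj] at hcmp
        exact hcmp
      simp only [eval_append, eval_cons, eval_powWord, h1])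
    rw [hsplit] at hrep
    have hlen := sLex_length_le hlt
    have hcp : (p * c : ℤ).natAbs ≤ p * (2 * q) := by
      rw [Int.natAbs_mul, Int.natAbs_natCast]
      exact Nat.mul_le_mul_left p hcb
    have hic := hb i (by simp)
    have hr2 : 2 ≤ r := by
      by_contra! h
      have := Nat.mul_le_mul_left p (show r ≤ 1 by omega)
      omega
    have hrN : 2 * N.natAbs ≤ (r * N : ℤ).natAbs := by
      rw [Int.natAbs_mul, Int.natAbs_natCast]
      exact Nat.mul_le_mul_right _ hr2
    have hT := length_le_tailWord l₀
    rw [hV, hsplit] at hlen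
    -- Let `u` be the upper part, with `k₀` letters `T`. Since `|n'| ≥ 2|N| - |i + pc|` and `|N| ≥
    -- k₀ + |u|`, the bounds `hlen` and `hrep` give `k₀ + |u| ≤ 2 + 2(q + 2pq)`. As `|u| ≥ k₀`, this
    -- contradicts `k₀ ≥ 3 + q + 2pq`, which is the reason for the choice of `J`.
    simp only [slopeWord, List.length_append, List.length_cons, List.length_nil,
      List.length_replicate, length_powWord] at hlen hrep hgN hjJ
    omega

/-- With at least `J` letters `T`, normality of `t^k u` passes to its suffix `t^J u`, and the
converse is `mem_coreLang_of_mem_normalLang`. The remaining words have few, bounded blocks and form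
a finite set. -/
theorem isRegular_coreLang (hp : 1 ≤ p) (hpq : p < q) (hd : p ∣ q) :
    (coreLang p q).IsRegular := by
  set J := 3 + q + p * (2 * q) with hJ
  have hfin : ({w | w ∈ coreLang p q ∧ w.count .T ≤ J} : Set (List Letter)).Finite := by
    refine (List.finite_length_le Letter (3 * q + J * (q + 1))).subset ?_
    rintro w ⟨⟨⟨n, l, rfl, -⟩, hnf⟩, hJ⟩
    rw [count_T_slopeWord] at hJ
    have hg := (geodesic_of_llnf_eq hnf).of_append_left
    have h1 := natAbs_lt_of_geodesic_powWord hpq hg.of_append_right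
    have h2 := length_tailWord_le fun i hi => (natAbs_lt_of_geodesic hp hpq hg hi).le
    have h3 := Nat.mul_le_mul_right (q + 1) hJ
    change (slopeWord n l).length ≤ _
    rw [slopeWord, List.length_append, length_powWord]
    omega
  let S : Language Letter := {w | w ∈ coreLang p q ∧ w.count .T ≤ J}
  have h := (isRegular_normalLang_replicate hp hpq hd J).add (isRegular_of_finite (L := S) hfin)
  convert h using 1
  ext w
  rw [Language.mem_add]
  constructor
  · intro hw
    rcases le_total (w.count .T) J with h | h
    · exact Or.inr ⟨hw, h⟩
    · refine Or.inl ⟨hw.1, ?_⟩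
      obtain ⟨i, hi⟩ := Nat.exists_eq_add_of_le' h
      have := hw.2
      rw [hi, ← replicate_t_append_assoc] at this
      exact llnf_eq_of_append_left this
  · rintro (h | h)
    · exact mem_coreLang_of_mem_normalLang hp hpq hd h
    · exact h.1

end Horocyclic

end BSol

namespace BSol

/-! ### One-counter automata -/

section Nest

variable {σ : Type} (D : DFA Letter σ)

/-- The words `t^k u` where the automaton `D` accepts the word `u`, in which the letter `t` does
not occur and the letter `T` occurs `k` times. -/
def nestLang : Language Letter :=
  {w | ∃ u ∈ D.accepts, .t ∉ u ∧ w = List.replicate (u.count .T) .t ++ u}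

theorem replicate_t_append_inj {k l : ℕ} {x y : List Letter} (hx : x.head? ≠ some .t)
    (hy : y.head? ≠ some .t)
    (h : List.replicate k .t ++ x = List.replicate l .t ++ y) : k = l ∧ x = y := by
  induction k generalizing l with
  | zero =>
    cases l with
    | zero => exact ⟨rfl, h⟩
    | succ l =>
      rw [List.replicate_zero, List.nil_append] at h
      simp [h, List.replicate_succ] at hx
  | succ k ih =>
    cases l with
    | zero =>
      rw [List.replicate_zero, List.nil_append] at h
      simp [← h, List.replicate_succ] at hy
    | succ l =>
      obtain ⟨rfl, rfl⟩ := ih (l := l) (by simpa [List.replicate_succ] using h)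
      exact ⟨rfl, rfl⟩

theorem head?_ne_of_notMem {u : List Letter} (h : .t ∉ u) : u.head? ≠ some .t :=
  fun h' => h (List.mem_of_head? h')

theorem mem_nestLang_iff {k : ℕ} {x : List Letter} (hx : x.head? ≠ some .t) :
    List.replicate k .t ++ x ∈ nestLang D ↔ x ∈ D.accepts ∧ .t ∉ x ∧ k = x.count .T := by
  constructor
  · rintro ⟨u, hu, ht, h⟩
    obtain ⟨rfl, rfl⟩ := replicate_t_append_inj hx (head?_ne_of_notMem ht) h
    exact ⟨hu, ht, rfl⟩
  · rintro ⟨h, ht, rfl⟩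
    exact ⟨x, h, ht, rfl⟩

/-- The moves of the one-counter automaton for `nestLang D`. In the states `Sum.inl z` only letters
`t` have been read. In `Sum.inr (s, some z)` the automaton `D` is in the state `s`, and `z` tells
whether the counter is zero; in `Sum.inr (s, none)` this still has to be tested. -/
def nestMove : Bool ⊕ σ × Option Bool → Bool → Option Letter →
    Option ((Bool ⊕ σ × Option Bool) × CounterOp)
  | .inl _, _, some .t => some (.inl false, .inc)
  | .inl _, _, some .T => some (.inr (D.step D.start .T, none), .dec)
  | .inl z, _, some .a => some (.inr (D.step D.start .a, some z), .keep)
  | .inl z, _, some .A => some (.inr (D.step D.start .A, some z), .keep)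
  | .inr (s, some _), _, some .T => some (.inr (D.step s .T, none), .dec)
  | .inr (s, some z), _, some .a => some (.inr (D.step s .a, some z), .keep)
  | .inr (s, some z), _, some .A => some (.inr (D.step s .A, some z), .keep)
  | .inr (s, none), z, none => some (.inr (s, some z), .keep)
  | _, _, _ => none

/-- The one-counter automaton for `nestLang D`. -/
def nestCounter : OneCounter Letter (Bool ⊕ σ × Option Bool) where
  start := .inl true
  accept := {x | (x = .inl true ∧ D.start ∈ D.accept) ∨ ∃ s ∈ D.accept, x = .inr (s, some true)}
  move := nestMove D
  det := by
    rintro (z | ⟨s, z | z⟩) b h (_ | _ | _ | _) <;> simp_all [nestMove]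

/-- The relation between the word read so far and the current configuration. -/
def nestInv (v : List Letter) : (Bool ⊕ σ × Option Bool) × ℕ → Prop
  | (.inl z, c) => v = List.replicate c .t ∧ z = decide (c = 0)
  | (.inr (s, o), c) => ∃ u, .t ∉ u ∧ v = List.replicate (c + u.count .T) .t ++ u ∧ D.eval u = s ∧
      ∀ z ∈ o, z = decide (c = 0)

theorem nestInv_step {v : List Letter} {c d : (Bool ⊕ σ × Option Bool) × ℕ} {x : Option Letter}
    (h : (nestCounter D).Step c x d) (hc : nestInv D v c) : nestInv D (v ++ x.toList) d := by
  obtain ⟨s, c⟩ := c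
  obtain ⟨s', d⟩ := d
  obtain ⟨op, hm, hop⟩ := h
  have down : ∀ {u : List Letter} {y : Letter}, .t ∉ u → y ≠ .t →
      D.eval (u ++ [y]) = D.step (D.eval u) y ∧ .t ∉ u ++ [y] := by
    intro u y hu hy
    exact ⟨D.eval_append_singleton u y, by simp [hu, hy.symm]⟩
  rcases s with z | ⟨s, _ | z⟩
  · obtain ⟨rfl, rfl⟩ := hc
    rcases x with _ | _ | _ | _ | _ <;>
      simp only [nestCounter, nestMove, Option.some.injEq, Prod.mk.injEq, reduceCtorEq] at hm <;>
      obtain ⟨rfl, rfl⟩ := hm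
    · simp only [CounterOp.apply, Option.some.injEq] at hop
      subst hop
      exact ⟨by simp [List.replicate_succ'], by simp⟩
    · cases c with
      | zero => simp [CounterOp.apply] at hop
      | succ c =>
        simp only [CounterOp.apply, Option.some.injEq] at hop
        subst hop
        exact ⟨[.T], by simp, by simp, rfl, by simp⟩
    · simp only [CounterOp.apply, Option.some.injEq] at hop
      subst hop
      exact ⟨[.a], by simp, by simp, rfl, by simp⟩
    · simp only [CounterOp.apply, Option.some.injEq] at hop
      subst hop
      exact ⟨[.A], by simp, by simp, rfl, by simp⟩
  · obtain ⟨u, hu, rfl, rfl, -⟩ := hc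
    rcases x with _ | _ | _ | _ | _ <;>
      simp only [nestCounter, nestMove, Option.some.injEq, Prod.mk.injEq, reduceCtorEq] at hm
    obtain ⟨rfl, rfl⟩ := hm
    simp only [CounterOp.apply, Option.some.injEq] at hop
    subst hop
    exact ⟨u, hu, by simp, rfl, by simp⟩
  · obtain ⟨u, hu, rfl, rfl, hz⟩ := hc
    obtain rfl := hz z rfl
    rcases x with _ | _ | _ | _ | _ <;>
      simp only [nestCounter, nestMove, Option.some.injEq, Prod.mk.injEq, reduceCtorEq] at hm <;>
      obtain ⟨rfl, rfl⟩ := hm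
    · cases c with
      | zero => simp [CounterOp.apply] at hop
      | succ c =>
        simp only [CounterOp.apply, Option.some.injEq] at hop
        subst hop
        obtain ⟨h1, h2⟩ := down (y := .T) hu (by simp)
        refine ⟨u ++ [.T], h2, ?_, h1, by simp⟩
        simp only [List.count_append, List.count_singleton_self, Option.toList_some,
          List.append_assoc]
        rw [show c + 1 + u.count .T = c + (u.count .T + 1) by ring]
    · simp only [CounterOp.apply, Option.some.injEq] at hop
      subst hop
      obtain ⟨h1, h2⟩ := down (y := .a) hu (by simp)
      exact ⟨u ++ [.a], h2, by simp, h1, by simp⟩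
    · simp only [CounterOp.apply, Option.some.injEq] at hop
      subst hop
      obtain ⟨h1, h2⟩ := down (y := .A) hu (by simp)
      exact ⟨u ++ [.A], h2, by simp, h1, by simp⟩

theorem nestInv_run {v w : List Letter} {c d : (Bool ⊕ σ × Option Bool) × ℕ}
    (h : (nestCounter D).Run c w d) (hc : nestInv D v c) : nestInv D (v ++ w) d := by
  induction h generalizing v with
  | refl c => simpa using hc
  | silent h _ ih => simpa using ih (nestInv_step D h hc)
  | read h _ ih => simpa using ih (nestInv_step D h hc)

theorem nestCounter_run_down {u : List Letter} (hu : .t ∉ u) (s : σ) (c : ℕ) :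
    (nestCounter D).Run (.inr (s, some (decide (c + u.count .T = 0))), c + u.count .T) u
      (.inr (D.evalFrom s u, some (decide (c = 0))), c) := by
  induction u generalizing s with
  | nil => exact .refl _
  | cons x u ih =>
    simp only [List.mem_cons, not_or] at hu
    have ih := ih hu.2 (D.step s x)
    cases x with
    | t => simp at hu
    | T =>
      rw [List.count_cons_self, ← add_assoc]
      refine .read (d := (.inr (D.step s .T, none), c + u.count .T)) ⟨.dec, rfl, rfl⟩ ?_
      refine .silent ?_ ih
      exact ⟨.keep, rfl, rfl⟩
    | a =>
      rw [List.count_cons_of_ne (by simp)]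
      refine .read ?_ ih
      exact ⟨.keep, rfl, rfl⟩
    | A =>
      rw [List.count_cons_of_ne (by simp)]
      refine .read ?_ ih
      exact ⟨.keep, rfl, rfl⟩

theorem nestCounter_run_up (k c : ℕ) {w : List Letter} {d : (Bool ⊕ σ × Option Bool) × ℕ}
    (h : (nestCounter D).Run (.inl (decide (c + k = 0)), c + k) w d) :
    (nestCounter D).Run (.inl (decide (c = 0)), c) (List.replicate k .t ++ w) d := by
  induction k generalizing c with
  | zero => exact h
  | succ k ih =>
    refine .read (d := (.inl false, c + 1)) ⟨.inc, rfl, rfl⟩ ?_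
    have := ih (c + 1) (by rwa [add_assoc, add_comm 1])
    simpa using this

theorem nestCounter_language : (nestCounter D).language = nestLang D := by
  ext w
  constructor
  · rintro ⟨⟨s, c⟩, h, ha⟩
    have hi := nestInv_run D h (v := []) ⟨rfl, rfl⟩
    rw [List.nil_append] at hi
    rcases ha with ⟨rfl, ha⟩ | ⟨s, ha, rfl⟩
    · obtain ⟨rfl, hc⟩ := hi
      obtain rfl : c = 0 := by simpa using hc
      exact ⟨[], ha, by simp, rfl⟩
    · obtain ⟨u, hu, rfl, rfl, hc⟩ := hi
      obtain rfl : c = 0 := by simpa using hc true rfl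
      exact ⟨u, ha, hu, by simp⟩
  · rintro ⟨u, ha, hu, rfl⟩
    cases u with
    | nil => exact ⟨_, .refl _, Or.inl ⟨rfl, ha⟩⟩
    | cons x u =>
      refine ⟨(.inr (D.evalFrom D.start (x :: u), some true), 0), ?_, Or.inr ⟨_, ha, rfl⟩⟩
      refine nestCounter_run_up D ((x :: u).count .T) 0 ?_
      rw [zero_add]
      simp only [List.mem_cons, not_or] at hu
      have h := nestCounter_run_down D hu.2 (D.step D.start x) 0
      rw [zero_add] at h
      cases x with
      | t => simp at hu
      | T =>
        rw [List.count_cons_self]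
        refine .read (d := (.inr (D.step D.start .T, none), u.count .T)) ⟨.dec, rfl, rfl⟩ ?_
        refine .silent ?_ h
        exact ⟨.keep, rfl, rfl⟩
      | a =>
        rw [List.count_cons_of_ne (by simp)]
        refine .read ?_ h
        exact ⟨.keep, rfl, rfl⟩
      | A =>
        rw [List.count_cons_of_ne (by simp)]
        refine .read ?_ h
        exact ⟨.keep, rfl, rfl⟩

theorem nestCounter_step_inr {c d : (Bool ⊕ σ × Option Bool) × ℕ} {x : Option Letter}
    (h : (nestCounter D).Step c x d) (hc : c.1.isRight) : d.1.isRight ∧ d.2 ≤ c.2 := by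
  obtain ⟨s, c⟩ := c
  obtain ⟨s', d⟩ := d
  obtain ⟨op, hm, hop⟩ := h
  rcases s with z | ⟨s, _ | z⟩
  · simp at hc
  all_goals
    rcases x with _ | _ | _ | _ | _ <;>
      simp only [nestCounter, nestMove, Option.some.injEq, Prod.mk.injEq, reduceCtorEq] at hm <;>
      obtain ⟨rfl, rfl⟩ := hm <;> cases c <;>
      simp only [CounterOp.apply, Option.some.injEq, reduceCtorEq] at hop <;> subst hop <;> simp

theorem nestCounter_run_inr {c d : (Bool ⊕ σ × Option Bool) × ℕ} {w : List Letter}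
    (h : (nestCounter D).Run c w d) (hc : c.1.isRight) : d.1.isRight := by
  induction h with
  | refl c => exact hc
  | silent h _ ih => exact ih (nestCounter_step_inr D h hc).1
  | read h _ ih => exact ih (nestCounter_step_inr D h hc).1

/-- The counter decreases only in moves to a state `Sum.inr`; such states are never left, and no
move from them increases the counter. -/
theorem nestCounter_oneTurn : (nestCounter D).OneTurn := by
  intro u v x y c₁ c₂ c₃ c₄ _ h₁₂ hlt h₂₃ h₃₄
  have h₂ : c₂.1.isRight := by
    obtain ⟨s, c⟩ := c₁
    obtain ⟨s', d⟩ := c₂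
    obtain ⟨op, hm, hop⟩ := h₁₂
    rcases s with z | ⟨s, _ | z⟩ <;> rcases x with _ | _ | _ | _ | _ <;>
      simp only [nestCounter, nestMove, Option.some.injEq, Prod.mk.injEq, reduceCtorEq] at hm <;>
      obtain ⟨rfl, rfl⟩ := hm <;> first | rfl | skip
    simp only [CounterOp.apply, Option.some.injEq] at hop
    subst hop
    simp at hlt
  exact (nestCounter_step_inr D h₃₄ (nestCounter_run_inr D h₂₃ h₂)).2

theorem isDetLinearOneCounter_nestLang [Finite σ] : IsDetLinearOneCounter (nestLang D) :=
  ⟨_, inferInstance, nestCounter D, nestCounter_oneTurn D, nestCounter_language D⟩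

end Nest

end BSol

namespace BSol

/-! ### Unambiguous linear grammars -/

section Grammar

/-- In a linear grammar every derivation of a word is leftmost. -/
theorem LinearGrammar.exists_leftmost {α : Type} {g : ContextFreeGrammar α} (hg : LinearGrammar g)
    {F : List (Symbol α g.NT)} {w : List α} (h : g.Derives F (w.map .terminal))
    (hF : (∃ x : List α, F = x.map .terminal) ∨ ∃ (x : List α) (n : g.NT) (y : List α),
      F = x.map .terminal ++ [.nonterminal n] ++ y.map .terminal) :
    ∃ rs, LeftmostDerivation g rs F (w.map .terminal) := by
  induction h using Relation.ReflTransGen.head_induction_on with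
  | refl => exact ⟨[], .refl _⟩
  | @head F F' hs _ ih =>
    obtain ⟨r, hr, hrw⟩ := hs
    obtain ⟨P, Q, rfl, rfl⟩ := hrw.exists_parts
    obtain ⟨x, y, rfl, rfl⟩ : ∃ x y : List α, P = x.map .terminal ∧ Q = y.map .terminal := by
      rcases hF with ⟨x, hx⟩ | ⟨x, n, y, hx⟩
      · have : (Symbol.nonterminal r.input : Symbol α g.NT) ∈ x.map .terminal := by
          rw [← hx]
          simp
        simp at this
      · clear * - hx
        induction x generalizing P with
        | nil =>
          cases P with
          | nil => exact ⟨[], y, rfl, by simpa using (List.cons.inj hx).2⟩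
          | cons s P =>
            have h1 : P ++ [Symbol.nonterminal r.input] ++ Q = y.map .terminal :=
              (List.cons.inj hx).2
            have : (Symbol.nonterminal r.input : Symbol α g.NT) ∈ y.map .terminal := by
              rw [← h1]
              simp
            simp at this
        | cons c x ih =>
          cases P with
          | nil => simp at hx
          | cons s P =>
            simp only [List.map_cons, List.cons_append, List.cons.injEq] at hx
            obtain ⟨x', y', rfl, rfl⟩ := ih P hx.2
            exact ⟨c :: x', y', by simp [hx.1], rfl⟩
    obtain ⟨rs, hrs⟩ := ih (by
      rcases hg r hr with ⟨z, hz⟩ | ⟨z, n, z', hz⟩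
      · exact Or.inl ⟨x ++ z ++ y, by simp [hz]⟩
      · exact Or.inr ⟨x ++ z, n, z' ++ y, by simp [hz]⟩)
    exact ⟨r :: rs, .step hr hrs⟩

variable {σ : Type} (D : DFA Letter σ)

/-- The word `t` if the letter is `T`, and the empty word otherwise. -/
def leadWord (c : Letter) : List Letter := if c = .T then [.t] else []

/-- The rule by which `D` is run backwards over the letter `c`, entered from the state `s`. -/
def letterRule (s : σ) (c : Letter) : ContextFreeRule Letter (Option σ) :=
  ⟨some (D.step s c), (leadWord c).map .terminal ++ [.nonterminal (some s)] ++ [.terminal c]⟩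

/-- The rule that ends a derivation. -/
def endRule : ContextFreeRule Letter (Option σ) := ⟨some D.start, []⟩

/-- The rule that starts a derivation. -/
def startRule (s : σ) : ContextFreeRule Letter (Option σ) := ⟨none, [.nonterminal (some s)]⟩

open Classical in
/-- A grammar for `nestLang D`. -/
noncomputable abbrev nestGrammar [Finite σ] : ContextFreeGrammar Letter where
  NT := Option σ
  initial := none
  rules := (Set.toFinite ({endRule D} ∪ startRule '' D.accept ∪
    (fun x : σ × Letter => letterRule D x.1 x.2) '' {x | x.2 ≠ .t})).toFinset

variable [Finite σ]

theorem mem_nestGrammar_rules {r : ContextFreeRule Letter (Option σ)} :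
    r ∈ (nestGrammar D).rules ↔ r = endRule D ∨ (∃ s ∈ D.accept, r = startRule s) ∨
      ∃ s c, c ≠ .t ∧ r = letterRule D s c := by
  simp only [nestGrammar, Set.Finite.mem_toFinset, Set.mem_union, Set.mem_singleton_iff,
    Set.mem_image, Prod.exists, or_assoc]
  refine or_congr Iff.rfl (or_congr ?_ ?_)
  · exact ⟨fun ⟨s, h, e⟩ => ⟨s, h, e.symm⟩, fun ⟨s, h, e⟩ => ⟨s, h, e.symm⟩⟩
  · exact ⟨fun ⟨s, c, h, e⟩ => ⟨s, c, h, e.symm⟩, fun ⟨s, c, h, e⟩ => ⟨s, c, h, e.symm⟩⟩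

theorem linearGrammar_nestGrammar : LinearGrammar (nestGrammar D) := by
  intro r hr
  rcases (mem_nestGrammar_rules D).1 hr with rfl | ⟨s, -, rfl⟩ | ⟨s, c, -, rfl⟩
  · exact Or.inl ⟨[], rfl⟩
  · exact Or.inr ⟨[], some s, [], rfl⟩
  · exact Or.inr ⟨leadWord c, some s, [c], rfl⟩

/-- The rules that derive the word `t^k u`, for the reversal of `u`. -/
def derivationRules : List Letter → List (ContextFreeRule Letter (Option σ))
  | [] => [endRule D]
  | c :: v => letterRule D (D.eval v.reverse) c :: derivationRules v

theorem replicate_count_concat (u : List Letter) (c : Letter) :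
    leadWord c ++ List.replicate (u.count .T) .t =
      List.replicate ((u ++ [c]).count .T) .t := by
  by_cases h : c = .T
  · subst h
    simp [leadWord, List.replicate_succ]
  · simp [leadWord, h]

theorem eq_of_terminal_append_eq {α N : Type} {x x' : List α} {n n' : N} {y y' : List (Symbol α N)}
    (h : x.map Symbol.terminal ++ [.nonterminal n] ++ y =
      x'.map Symbol.terminal ++ [.nonterminal n'] ++ y') : x = x' ∧ n = n' ∧ y = y' := by
  induction x generalizing x' with
  | nil =>
    cases x' with
    | nil => simpa using h
    | cons c x' => simp at h
  | cons c x ih =>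
    cases x' with
    | nil => simp at h
    | cons c' x' =>
      simp only [List.map_cons, List.cons_append, List.cons.injEq, Symbol.terminal.injEq] at h
      obtain ⟨rfl, rfl, rfl⟩ := ih h.2
      exact ⟨by rw [h.1], rfl, rfl⟩

theorem nestGrammar_derivation_terminal {rs : List (ContextFreeRule Letter (nestGrammar D).NT)}
    {x : List Letter} {F : List (Symbol Letter (nestGrammar D).NT)}
    (h : LeftmostDerivation (nestGrammar D) rs (x.map .terminal) F) :
    rs = [] ∧ F = x.map .terminal := by
  generalize hE : (x.map .terminal : List (Symbol Letter (nestGrammar D).NT)) = E at h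
  cases h with
  | refl => exact ⟨rfl, rfl⟩
  | @step r _ _ _ _ =>
    have : (Symbol.nonterminal r.input : Symbol Letter (nestGrammar D).NT) ∈ x.map .terminal := by
      rw [hE]
      simp
    simp at this

/-- The rules peel off the letters of `u` from the last to the first, each `T` together with a
leading `t`. The rule sequence is a function of `u`, so unambiguity reduces to the uniqueness of
`u`. -/
theorem nestGrammar_derivation {rs : List (ContextFreeRule Letter (nestGrammar D).NT)} {s : σ}
    {x y w : List Letter}
    (h : LeftmostDerivation (nestGrammar D) rs
      (x.map .terminal ++ [.nonterminal (some s)] ++ y.map .terminal) (w.map .terminal)) :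
    ∃ u, .t ∉ u ∧ D.eval u = s ∧ w = x ++ (List.replicate (u.count .T) .t ++ u) ++ y ∧
      rs = derivationRules D u.reverse := by
  generalize hE : (x.map .terminal ++ [.nonterminal (some s)] ++ y.map .terminal :
    List (Symbol Letter (nestGrammar D).NT)) = E at h
  generalize hW : (w.map .terminal : List (Symbol Letter (nestGrammar D).NT)) = W at h
  induction h generalizing s x y with
  | refl v =>
    have : (Symbol.nonterminal (some s) : Symbol Letter (nestGrammar D).NT) ∈ w.map .terminal := by
      rw [hW, ← hE]
      simp
    simp at this
  | @step r rs x' y' v hr hd ih =>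
    obtain ⟨rfl, hn, rfl⟩ := eq_of_terminal_append_eq hE
    rcases (mem_nestGrammar_rules D).1 hr with rfl | ⟨s, -, rfl⟩ | ⟨s', c, hc, rfl⟩
    · have h' : LeftmostDerivation (nestGrammar D) rs ((x ++ y).map .terminal) v := by
        simpa [endRule] using hd
      obtain ⟨rfl, rfl⟩ := nestGrammar_derivation_terminal D h'
      have : w = x ++ y := by
        refine List.map_injective_iff.2 (fun _ _ => ?_) hW
        exact Symbol.terminal.inj
      exact ⟨[], by simp, (Option.some.inj hn).symm, by simpa using this, rfl⟩
    · simp [startRule] at hn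
    · obtain ⟨u, hu, rfl, rfl, rfl⟩ := ih (s := s') (x := x ++ leadWord c) (y := c :: y)
        (by simp [letterRule]) hW
      refine ⟨u ++ [c], by simp [hu, hc.symm], ?_, ?_, ?_⟩
      · rw [DFA.eval_append_singleton]
        exact (Option.some.inj hn).symm
      · rw [← replicate_count_concat]
        simp
      · simp [derivationRules]

theorem nestGrammar_start {rs : List (ContextFreeRule Letter (nestGrammar D).NT)} {w : List Letter}
    (h : LeftmostDerivation (nestGrammar D) rs [.nonterminal none] (w.map .terminal)) :
    ∃ u ∈ D.accepts, .t ∉ u ∧ w = List.replicate (u.count .T) .t ++ u ∧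
      rs = startRule (D.eval u) :: derivationRules D u.reverse := by
  generalize hE : ([.nonterminal none] : List (Symbol Letter (nestGrammar D).NT)) = E at h
  generalize hW : (w.map .terminal : List (Symbol Letter (nestGrammar D).NT)) = W at h
  cases h with
  | refl =>
    subst hE
    cases w <;> simp at hW
  | @step r rs x' y' _ hr hd =>
    obtain ⟨rfl, hn, rfl⟩ := eq_of_terminal_append_eq (x := []) (y := []) hE
    subst hW
    rcases (mem_nestGrammar_rules D).1 hr with rfl | ⟨s, hs, rfl⟩ | ⟨s', c, hc, rfl⟩
    · simp [endRule] at hn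
    · obtain ⟨u, hu, rfl, rfl, rfl⟩ := nestGrammar_derivation D (x := []) (y := []) hd
      exact ⟨u, hs, hu, by simp, rfl⟩
    · simp [letterRule] at hn

theorem unambiguous_nestGrammar : UnambiguousGrammar (nestGrammar D) := by
  intro w rs rs' h h'
  obtain ⟨u, -, hu, rfl, rfl⟩ := nestGrammar_start D h
  obtain ⟨u', -, hu', e, rfl⟩ := nestGrammar_start D h'
  obtain ⟨-, rfl⟩ := replicate_t_append_inj (head?_ne_of_notMem hu) (head?_ne_of_notMem hu') e
  rfl

theorem nestGrammar_derives {u : List Letter} (hu : .t ∉ u) :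
    (nestGrammar D).Derives [.nonterminal (some (D.eval u))]
      ((List.replicate (u.count .T) Letter.t ++ u).map .terminal) := by
  induction u using List.reverseRecOn with
  | nil =>
    exact ContextFreeGrammar.Produces.single
      ⟨endRule D, (mem_nestGrammar_rules D).2 (Or.inl rfl), ContextFreeRule.Rewrites.head []⟩
  | append_singleton u c ih =>
    simp only [List.mem_append, List.mem_singleton, not_or] at hu
    rw [D.eval_append_singleton]
    have h1 : (nestGrammar D).Produces [.nonterminal (some (D.step (D.eval u) c))]
        ((leadWord c).map .terminal ++ [.nonterminal (some (D.eval u))] ++ [.terminal c]) :=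
      ⟨letterRule D (D.eval u) c, (mem_nestGrammar_rules D).2
        (Or.inr (Or.inr ⟨_, _, Ne.symm hu.2, rfl⟩)), ContextFreeRule.Rewrites.input_output⟩
    have h2 := h1.trans_derives (((ih hu.1).append_left _).append_right _)
    rw [← replicate_count_concat]
    simpa using h2

theorem nestGrammar_language : (nestGrammar D).language = nestLang D := by
  ext w
  rw [ContextFreeGrammar.mem_language_iff]
  constructor
  · intro h
    obtain ⟨rs, hrs⟩ := (linearGrammar_nestGrammar D).exists_leftmost h
      (Or.inr ⟨[], none, [], rfl⟩)
    obtain ⟨u, hu, ht, rfl, -⟩ := nestGrammar_start D hrs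
    exact ⟨u, hu, ht, rfl⟩
  · rintro ⟨u, hu, ht, rfl⟩
    have h1 : (nestGrammar D).Produces [.nonterminal none] [.nonterminal (some (D.eval u))] :=
      ⟨startRule (D.eval u), (mem_nestGrammar_rules D).2 (Or.inr (Or.inl ⟨_, hu, rfl⟩)),
        ContextFreeRule.Rewrites.input_output⟩
    exact h1.trans_derives (nestGrammar_derives D ht)

theorem isUnambiguousLinear_nestLang : IsUnambiguousLinear (nestLang D) :=
  ⟨nestGrammar D, linearGrammar_nestGrammar D, unambiguous_nestGrammar D, nestGrammar_language D⟩

end Grammar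

end BSol

namespace BSol

/-! ### Rational growth -/

section Growth

open Polynomial

/-- The contribution of a letter of `u` to the length of `t^k u`, where `k` is the number of
letters `T` of `u`. -/
def letterWeight (c : Letter) : ℕ := if c = .T then 2 else 1

/-- The length of `t^k u`, where `k` is the number of letters `T` of `u`. -/
def nestLength (u : List Letter) : ℕ := u.count .T + u.length

theorem nestLength_cons (c : Letter) (u : List Letter) :
    nestLength (c :: u) = letterWeight c + nestLength u := by
  cases c <;> simp [nestLength, letterWeight] <;> ring

theorem one_le_letterWeight (c : Letter) : 1 ≤ letterWeight c := by
  cases c <;> simp [letterWeight]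

variable {σ : Type} (D : DFA Letter σ)

/-- The words accepted from the state `s` that contribute to the growth in degree `n`. -/
def weightedWords (s : σ) (n : ℕ) : Set (List Letter) :=
  {u | D.evalFrom s u ∈ D.accept ∧ nestLength u = n}

theorem finite_weightedWords (s : σ) (n : ℕ) : (weightedWords D s n).Finite :=
  (List.finite_length_le Letter n).subset fun u hu => by
    have := hu.2
    simp only [nestLength] at this
    change u.length ≤ n
    omega

noncomputable instance : Fintype Letter := Fintype.ofFinite _

open Classical in
-- Splitting off the first letter gives the linear recursion behind the transfer matrix.
theorem ncard_weightedWords (s : σ) (n : ℕ) :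
    (weightedWords D s n).ncard = (if s ∈ D.accept ∧ n = 0 then 1 else 0) +
      ∑ c : Letter, if letterWeight c ≤ n then
        (weightedWords D (D.step s c) (n - letterWeight c)).ncard else 0 := by
  rw [Set.ncard_eq_toFinset_card _ (finite_weightedWords D s n),
    Finset.card_eq_sum_card_fiberwise (f := List.head?) (t := Finset.univ) (by simp),
    Fintype.sum_option]
  congr 1
  · split_ifs with h
    · rw [Finset.card_eq_one]
      refine ⟨[], ?_⟩
      ext u
      simp only [Finset.mem_filter, Set.Finite.mem_toFinset, List.head?_eq_none_iff,
        Finset.mem_singleton, and_iff_right_iff_imp]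
      rintro rfl
      exact ⟨h.1, h.2.symm⟩
    · rw [Finset.card_eq_zero, Finset.filter_eq_empty_iff]
      intro u hu hn
      rw [Set.Finite.mem_toFinset] at hu
      rw [List.head?_eq_none_iff] at hn
      subst hn
      exact h ⟨hu.1, hu.2.symm⟩
  · refine Finset.sum_congr rfl fun c _ => ?_
    split_ifs with h
    · rw [Set.ncard_eq_toFinset_card _ (finite_weightedWords D _ _)]
      symm
      refine Finset.card_bij (fun u _ => c :: u) ?_ ?_ ?_
      · intro u hu
        rw [Set.Finite.mem_toFinset] at hu
        rw [Finset.mem_filter, Set.Finite.mem_toFinset]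
        refine ⟨⟨hu.1, ?_⟩, rfl⟩
        rw [nestLength_cons, hu.2]
        omega
      · intro u _ v _ h
        exact (List.cons.inj h).2
      · intro u hu
        rw [Finset.mem_filter, Set.Finite.mem_toFinset] at hu
        obtain ⟨v, rfl⟩ := List.head?_eq_some_iff.1 hu.2
        refine ⟨v, ?_, rfl⟩
        rw [Set.Finite.mem_toFinset]
        refine ⟨hu.1.1, ?_⟩
        have := hu.1.2
        rw [nestLength_cons] at this
        omega
    · rw [Finset.card_eq_zero, Finset.filter_eq_empty_iff]
      intro u hu hn
      rw [Set.Finite.mem_toFinset] at hu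
      obtain ⟨v, rfl⟩ := List.head?_eq_some_iff.1 hn
      have := hu.2
      rw [nestLength_cons] at this
      omega

/-- The generating function of the words accepted from the state `s`. -/
noncomputable def weightedSeries (s : σ) : PowerSeries ℚ :=
  PowerSeries.mk fun n => ((weightedWords D s n).ncard : ℚ)

open Classical in
theorem weightedSeries_eq (s : σ) :
    weightedSeries D s = (if s ∈ D.accept then 1 else 0) +
      ∑ c : Letter, (PowerSeries.X : PowerSeries ℚ) ^ letterWeight c *
        weightedSeries D (D.step s c) := by
  ext n
  simp only [weightedSeries, map_add, map_sum, PowerSeries.coeff_mk,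
    PowerSeries.coeff_X_pow_mul', ncard_weightedWords D s n, Nat.cast_add, Nat.cast_sum]
  congr 1
  · by_cases h : s ∈ D.accept <;> simp [h, PowerSeries.coeff_one]
  · exact Finset.sum_congr rfl fun c _ => by split_ifs <;> simp

/-- The transfer-matrix method: the series of all states solve `M F = e` with polynomial entries,
and Cramer's rule gives `det M` as denominator. -/
theorem isRationalSeries_weightedSeries [Finite σ] (s : σ) :
    IsRationalSeries (weightedSeries D s) := by
  classical
  have := Fintype.ofFinite σ
  let M : Matrix σ σ ℚ[X] := 1 - Matrix.of fun s s' =>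
    ∑ c : Letter, if D.step s c = s' then X ^ letterWeight c else 0
  let e : σ → ℚ[X] := fun s => if s ∈ D.accept then 1 else 0
  let φ : ℚ[X] →+* PowerSeries ℚ := Polynomial.coeToPowerSeries.ringHom
  have hφX : φ X = PowerSeries.X := Polynomial.coe_X
  have hM : (φ.mapMatrix M).mulVec (weightedSeries D) = fun s => φ (e s) := by
    have hsub : φ.mapMatrix M = 1 - Matrix.of fun s s' =>
        ∑ c : Letter, if D.step s c = s' then (PowerSeries.X : PowerSeries ℚ) ^ letterWeight c
          else 0 := by
      simp only [M, map_sub, map_one]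
      congr 1
      ext1 i j
      simp [RingHom.mapMatrix_apply, Matrix.map_apply, apply_ite φ, hφX]
    funext s
    rw [hsub, Matrix.sub_mulVec, Matrix.one_mulVec, Pi.sub_apply]
    conv_lhs => rw [weightedSeries_eq D s]
    have h1 : (Matrix.of (fun s s' => ∑ c : Letter, if D.step s c = s' then
        (PowerSeries.X : PowerSeries ℚ) ^ letterWeight c else 0)).mulVec (weightedSeries D) s =
        ∑ c : Letter, (PowerSeries.X : PowerSeries ℚ) ^ letterWeight c *
          weightedSeries D (D.step s c) := by
      simp only [Matrix.mulVec, dotProduct, Matrix.of_apply, Finset.sum_mul, ite_mul, zero_mul]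
      rw [Finset.sum_comm]
      simp
    rw [h1, add_sub_cancel_right]
    simp [e, apply_ite φ]
  refine ⟨(M.adjugate.mulVec e) s, M.det, ?_, ?_⟩
  -- Every letter has weight at least 1, so `M` becomes the identity at `X = 0`.
  · have h0 : Polynomial.constantCoeff M.det = 1 := by
      rw [RingHom.map_det]
      have : Polynomial.constantCoeff.mapMatrix M = 1 := by
        simp only [M, map_sub, map_one]
        rw [sub_eq_self]
        ext1 i j
        simp only [RingHom.mapMatrix_apply, Matrix.map_apply, Matrix.of_apply, map_sum,
          Matrix.zero_apply]
        refine Finset.sum_eq_zero fun c _ => ?_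
        have := one_le_letterWeight c
        split_ifs
        · simp [show ¬ 0 = letterWeight c by omega]
        · simp
      rw [this, Matrix.det_one]
    rw [Polynomial.constantCoeff_apply] at h0
    rw [h0]
    exact one_ne_zero
  · have h1 : (φ.mapMatrix M.adjugate).mulVec ((φ.mapMatrix M).mulVec (weightedSeries D)) s =
        φ M.det * weightedSeries D s := by
      rw [Matrix.mulVec_mulVec, ← map_mul, Matrix.adjugate_mul]
      have : φ.mapMatrix (M.det • (1 : Matrix σ σ ℚ[X])) =
          φ M.det • (1 : Matrix σ σ (PowerSeries ℚ)) := by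
        ext1 i j
        by_cases h : i = j <;> simp [RingHom.mapMatrix_apply, Matrix.map_apply,
          h]
      rw [this, Matrix.smul_mulVec, Matrix.one_mulVec, Pi.smul_apply, smul_eq_mul]
    change φ M.det * weightedSeries D s = φ (∑ x, M.adjugate s x * e x)
    rw [← h1, hM]
    rw [map_sum]
    simp [Matrix.mulVec, dotProduct]

/-! ### From weighted words to the growth of `⟨a⟩`. -/

variable {p q : ℕ}

theorem geodesicLength_eval {w : List Letter} (h : llnf p q w = w) :
    geodesicLength p q (eval p q w) = w.length := by
  refine le_antisymm (Nat.sInf_le ⟨w, rfl, rfl⟩) ?_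
  refine le_csInf ⟨_, w, rfl, rfl⟩ ?_
  rintro _ ⟨v, hv, rfl⟩
  exact geodesic_of_llnf_eq h v hv

/-- Each element of `⟨a⟩` has exactly one normal form `t^k u`, whose length is its geodesic length,
and `u` is recovered by deleting the leading letters `t`. -/
theorem horocyclicGrowth_eq (hD : horocyclicLang p q = nestLang D)
    (ht : ∀ u ∈ D.accepts, .t ∉ u) : horocyclicGrowth p q = weightedSeries D D.start := by
  ext n
  rw [horocyclicGrowth, weightedSeries, PowerSeries.coeff_mk, PowerSeries.coeff_mk]
  congr 1
  have hmem : ∀ u ∈ D.accepts, List.replicate (u.count .T) Letter.t ++ u ∈ horocyclicLang p q := by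
    intro u hu
    rw [hD]
    exact ⟨u, hu, ht u hu, rfl⟩
  have himg : {g : BS p q | g ∈ horocyclicSubgroup p q ∧ geodesicLength p q g = n} =
      (fun u : List Letter => eval p q (List.replicate (u.count .T) .t ++ u)) ''
        weightedWords D D.start n := by
    ext g
    constructor
    · rintro ⟨hg, hn⟩
      obtain ⟨N, rfl⟩ := Subgroup.mem_zpowers_iff.1 hg
      have he := eval_llnf (p := p) (q := q) (powWord N)
      rw [eval_powWord] at he
      have hw : llnf p q (powWord N) ∈ horocyclicLang p q := by
        refine ⟨?_, llnf_llnf _⟩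
        rw [IsHorocyclic, he]
        exact hg
      have hl := geodesicLength_eval hw.2
      rw [hD] at hw
      obtain ⟨u, hu, -, hu'⟩ := hw
      rw [he, hn, hu'] at hl
      rw [hu'] at he
      exact ⟨u, ⟨hu, by simpa [nestLength] using hl.symm⟩, he⟩
    · rintro ⟨u, ⟨hu, hn⟩, rfl⟩
      obtain ⟨h1, h2⟩ := hmem u hu
      refine ⟨h1, ?_⟩
      dsimp only
      rw [geodesicLength_eval h2, ← hn]
      simp [nestLength]
  rw [himg]
  refine Set.InjOn.ncard_image ?_
  rintro u ⟨hu, -⟩ v ⟨hv, -⟩ h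
  have h3 : List.replicate (u.count .T) Letter.t ++ u = List.replicate (v.count .T) .t ++ v := by
    rw [← (hmem u hu).2, ← (hmem v hv).2]
    exact llnf_congr h
  exact (replicate_t_append_inj (head?_ne_of_notMem (ht u hu)) (head?_ne_of_notMem (ht v hv)) h3).2

end Growth

end BSol

namespace BSol

/-! ### Recognition in logarithmic space -/

section LogSpace

open WorkTapeMachine

/-- The number with the given binary digits, the least significant one first. -/
def bitsVal : List Bool → ℕ
  | [] => 0
  | b :: L => b.toNat + 2 * bitsVal L

theorem bitsVal_append (K L : List Bool) :
    bitsVal (K ++ L) = bitsVal K + 2 ^ K.length * bitsVal L := by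
  induction K with
  | nil => simp [bitsVal]
  | cons b K ih => simp only [List.cons_append, bitsVal, ih, List.length_cons, pow_succ]; ring

theorem bitsVal_lt (L : List Bool) : bitsVal L < 2 ^ L.length := by
  induction L with
  | nil => simp [bitsVal]
  | cons b L ih =>
    simp only [bitsVal, List.length_cons, pow_succ]
    have := b.toNat_le
    omega

/-- The work tape that holds a mark followed by binary digits; `none` is the blank symbol and
`some none` is the mark. -/
def bitsTape (L : List Bool) : ℕ → Option (Option Bool)
  | 0 => some none
  | i + 1 => L[i]?.map some

theorem bitsTape_append (K L : List Bool) (i : ℕ) (h : i = K.length + 1) :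
    bitsTape (K ++ L) i = L.head?.map some := by
  subst h
  simp only [bitsTape]
  rw [List.getElem?_append_right le_rfl, Nat.sub_self, List.head?_eq_getElem?]

theorem update_bitsTape (K L : List Bool) (b : Bool) :
    Function.update (bitsTape (K ++ L)) (K.length + 1) (some (some b)) =
      bitsTape (K ++ b :: L.tail) := by
  funext i
  rcases eq_or_ne i (K.length + 1) with rfl | hi
  · rw [Function.update_self, bitsTape_append _ _ _ rfl]
    rfl
  · rw [Function.update_of_ne hi]
    cases i with
    | zero => rfl
    | succ i =>
      simp only [bitsTape]
      rcases Nat.lt_or_ge i K.length with h | h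
      · rw [List.getElem?_append_left h, List.getElem?_append_left h]
      · rw [List.getElem?_append_right h, List.getElem?_append_right h]
        obtain ⟨j, hj⟩ : ∃ j, i - K.length = j + 1 := ⟨i - K.length - 1, by omega⟩
        rw [hj]
        cases L <;> simp

/-- The phases of the machine for `nestLang`. -/
inductive Phase
  | init
  | main
  | inc
  | dec
  | back
  | zero
  | acc

instance : Finite Phase :=
  Finite.of_surjective (![.init, .main, .inc, .dec, .back, .zero, .acc] : Fin 7 → Phase) (by
    rintro (_ | _ | _ | _ | _ | _ | _)
    exacts [⟨0, rfl⟩, ⟨1, rfl⟩, ⟨2, rfl⟩, ⟨3, rfl⟩, ⟨4, rfl⟩, ⟨5, rfl⟩, ⟨6, rfl⟩])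

variable {σ : Type} (D : DFA Letter σ)

open Classical in
/-- The moves of a machine for `nestLang D`, which keeps a binary counter on its work tape. -/
noncomputable def tapeMove : Phase × Option σ → InputCell Letter → Option (Option Bool) →
    Option ((Phase × Option σ) × Option (Option Bool) × HeadMove × HeadMove)
  | (.init, o), _, _ => some ((.main, o), some none, .right, .stay)
  | (.main, none), .letter .t, g => some ((.inc, none), g, .right, .right)
  | (.main, some _), .letter .t, _ => none
  | (.main, o), .letter .T, g =>
    some ((.dec, some (D.step (o.getD D.start) .T)), g, .right, .right)
  | (.main, o), .letter c, g =>
    some ((.main, some (D.step (o.getD D.start) c)), g, .right, .stay)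
  | (.main, o), .rightEnd, g =>
    if o.getD D.start ∈ D.accept then some ((.zero, o), g, .stay, .right) else none
  | (.main, _), .leftEnd, _ => none
  | (.inc, o), _, some (some true) => some ((.inc, o), some (some false), .stay, .right)
  | (.inc, _), _, some none => none
  | (.inc, o), _, _ => some ((.back, o), some (some true), .stay, .left)
  | (.back, o), _, some none => some ((.main, o), some none, .stay, .stay)
  | (.back, o), _, g => some ((.back, o), g, .stay, .left)
  | (.dec, o), _, some (some false) => some ((.dec, o), some (some true), .stay, .right)
  | (.dec, o), _, some (some true) => some ((.back, o), some (some false), .stay, .left)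
  | (.dec, _), _, _ => none
  | (.zero, o), _, some (some false) => some ((.zero, o), some (some false), .stay, .right)
  | (.zero, o), _, none => some ((.acc, o), none, .stay, .stay)
  | (.zero, _), _, _ => none
  | (.acc, _), _, _ => none

/-- A machine for `nestLang D`. -/
noncomputable def tapeMachine : WorkTapeMachine Letter (Phase × Option σ) (Option (Option Bool)) where
  start := (.init, none)
  blank := none
  accept := {s | s.1 = .acc}
  move := tapeMove D

/-- The state of `D` that the machine holds after reading `t^k u`. -/
def heldState (u : List Letter) : Option σ := if u = [] then none else some (D.eval u)

theorem heldState_getD (u : List Letter) : (heldState D u).getD D.start = D.eval u := by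
  unfold heldState
  split_ifs with h
  · subst h
    rfl
  · rfl

theorem heldState_concat (u : List Letter) (c : Letter) :
    heldState D (u ++ [c]) = some (D.step (D.eval u) c) := by
  simp [heldState]

/-- The reachable configurations of the machine on the input `w`, together with the number of
letters not yet read and a bound for the number of moves before the next one is read. -/
inductive TapeInv (w : List Letter) :
    WorkTapeCfg (Phase × Option σ) (Option (Option Bool)) → ℕ → ℕ → Prop
  | init : TapeInv w ⟨(.init, none), 0, 0, fun _ => none⟩ (w.length + 1) 0
  | main {k u rest L} : w = List.replicate k .t ++ (u ++ rest) → .t ∉ u →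
      bitsVal L + u.count .T = k → 2 ^ L.length ≤ 2 * k + 1 →
      TapeInv w ⟨(.main, heldState D u), k + u.length + 1, 0, bitsTape L⟩ rest.length
        (L.length + 5)
  -- The digits `K` have been processed, and `2 ^ K.length` is the pending carry. A further carry
  -- lowers the bound by 1, since `2` per digit of `K` replaces `3` per digit of `L`.
  | inc {k rest K L} : w = List.replicate k .t ++ rest → bitsVal (K ++ L) + 2 ^ K.length = k →
      2 ^ (K ++ L).length ≤ 2 * k + 1 →
      TapeInv w ⟨(.inc, none), k + 1, K.length + 1, bitsTape (K ++ L)⟩ rest.length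
        (2 * K.length + 3 * L.length + 20)
  -- Here `2 ^ K.length` is the pending borrow. Leading zeros are never removed, so the number of
  -- digits is bounded through `k`, the largest value of the counter.
  | dec {k u rest K L} : w = List.replicate k .t ++ (u ++ rest) → .t ∉ u → u ≠ [] →
      bitsVal (K ++ L) + u.count .T = k + 2 ^ K.length → 2 ^ (K ++ L).length ≤ 2 * k + 1 →
      TapeInv w ⟨(.dec, heldState D u), k + u.length + 1, K.length + 1, bitsTape (K ++ L)⟩
        rest.length (2 * K.length + 3 * L.length + 20)
  | back {k u rest L j} : w = List.replicate k .t ++ (u ++ rest) → .t ∉ u →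
      bitsVal L + u.count .T = k → 2 ^ L.length ≤ 2 * k + 1 → j ≤ L.length →
      TapeInv w ⟨(.back, heldState D u), k + u.length + 1, j, bitsTape L⟩ rest.length
        (L.length + 6 + j)
  | zero {k u j L} : w = List.replicate k .t ++ u → .t ∉ u → D.eval u ∈ D.accept →
      2 ^ j * bitsVal L + u.count .T = k → 2 ^ (j + L.length) ≤ 2 * k + 1 →
      TapeInv w ⟨(.zero, heldState D u), k + u.length + 1, j + 1,
        bitsTape (List.replicate j false ++ L)⟩ 0 (L.length + 1)
  | acc {o i j f} : w ∈ nestLang D → 2 ^ (j - 1) ≤ 2 * w.length + 1 →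
      TapeInv w ⟨(.acc, o), i, j, f⟩ 0 0

theorem inputCell_append (v rest : List Letter) (i : ℕ) (h : i = v.length) :
    inputCell (v ++ rest) (i + 1) = match rest.head? with
      | some x => .letter x
      | none => .rightEnd := by
  subst h
  simp only [inputCell]
  rw [List.getElem?_append_right le_rfl, Nat.sub_self, List.head?_eq_getElem?]
  cases rest[0]? <;> rfl

theorem step_tapeMachine {w : List Letter} {s s' : Phase × Option σ} {i j : ℕ}
    {f : ℕ → Option (Option Bool)} {g : Option (Option Bool)} {m m' : HeadMove}
    (h : tapeMove D s (inputCell w i) (f j) = some (s', g, m, m')) :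
    (tapeMachine D).step w ⟨s, i, j, f⟩ =
      some ⟨s', min (m.apply i) (w.length + 1), m'.apply j, Function.update f j g⟩ := by
  simp [step, tapeMachine, h]

theorem step_tapeMachine_none {w : List Letter} {s : Phase × Option σ} {i j : ℕ}
    {f : ℕ → Option (Option Bool)} (h : tapeMove D s (inputCell w i) (f j) = none) :
    (tapeMachine D).step w ⟨s, i, j, f⟩ = none := by
  simp [step, tapeMachine, h]

theorem head?_append_ne {u rest : List Letter} (hu : .t ∉ u) (hne : u ≠ []) :
    (u ++ rest).head? ≠ some .t := by
  cases u with
  | nil => exact absurd rfl hne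
  | cons c u =>
    simp only [List.mem_cons, not_or] at hu
    simpa using Ne.symm hu.1

/-- The pair of unread letters and remaining moves decreases lexicographically, so the invariant
yields both termination and correctness at the halting configuration. -/
theorem tapeMachine_progress {w : List Letter}
    {c : WorkTapeCfg (Phase × Option σ) (Option (Option Bool))} {r m : ℕ}
    (h : TapeInv D w c r m) :
    ((tapeMachine D).step w c = none ∧ (c.state ∈ (tapeMachine D).accept ↔ w ∈ nestLang D)) ∨
    ∃ d r' m', (tapeMachine D).step w c = some d ∧ TapeInv D w d r' m' ∧
      (r' < r ∨ r' = r ∧ m' < m) := by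
  cases h with
  | init =>
    refine Or.inr ⟨_, w.length, 5, step_tapeMachine D rfl, ?_, Or.inl (Nat.lt_succ_self _)⟩
    have h1 : Function.update (fun _ : ℕ => (none : Option (Option Bool))) 0 (some none) =
        bitsTape [] := by
      funext i
      cases i <;> simp [bitsTape]
    have h2 := TapeInv.main (D := D) (w := w) (k := 0) (u := []) (rest := w) (L := [])
      rfl (by simp) rfl (by simp)
    rw [← h1] at h2
    have h3 : min (HeadMove.right.apply 0) (w.length + 1) = 1 := by
      simp [HeadMove.apply]
    rw [h3]
    exact h2
  | @main k u rest L hw hu hv hL =>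
    have hcell := inputCell_append (List.replicate k .t ++ u) rest (k + u.length) (by simp)
    rw [List.append_assoc, ← hw] at hcell
    have hlen : w.length = k + u.length + rest.length := by simp [hw, add_assoc]
    have hg : bitsTape L 0 = some none := rfl
    have hup : Function.update (bitsTape L) 0 (some none) = bitsTape L :=
      Function.update_eq_self 0 (bitsTape L)
    cases rest with
    | nil =>
      rw [List.append_nil] at hw
      have hmem : w ∈ nestLang D ↔ u ∈ D.accepts ∧ k = u.count .T := by
        rw [hw, mem_nestLang_iff D (head?_ne_of_notMem hu)]
        simp [hu]
      by_cases ha : D.eval u ∈ D.accept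
      · refine Or.inr ⟨_, _, L.length + 1,
            step_tapeMachine D (s' := (.zero, heldState D u))
          (g := some none) (m := .stay) (m' := .right) ?_, ?_, Or.inr ⟨rfl, ?_⟩⟩
        · rw [hcell, hg]
          simp [tapeMove, heldState_getD, ha]
        · have h := TapeInv.zero (D := D) (j := 0) hw hu ha (by simpa using hv)
            (by simpa using hL)
          rw [hup]
          have h3 : min (HeadMove.stay.apply (k + u.length + 1)) (w.length + 1) =
              k + u.length + 1 := by
            simp [HeadMove.apply, hlen]
          rw [h3]
          exact h
        · omega
      · refine Or.inl ⟨step_tapeMachine_none D ?_, ?_⟩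
        · rw [hcell, hg]
          simp [tapeMove, heldState_getD, ha]
        · rw [hmem]
          exact ⟨fun h => (nomatch h), fun h => absurd h.1 ha⟩
    | cons c rest =>
      have h3 : min (HeadMove.right.apply (k + u.length + 1)) (w.length + 1) =
          k + u.length + 1 + 1 := by
        simp only [HeadMove.apply, hlen, List.length_cons]
        omega
      have hw' : w = List.replicate k .t ++ ((u ++ [c]) ++ rest) := by simpa using hw
      by_cases hct : c = .t
      · subst hct
        by_cases hun : u = []
        · subst hun
          refine Or.inr ⟨_, _, 2 * 0 + 3 * L.length + 20,
              step_tapeMachine D (s' := (.inc, none))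
            (g := some none) (m := .right) (m' := .right) ?_, ?_,
            Or.inl (Nat.lt_succ_self _)⟩
          · rw [hcell, hg]
            rfl
          · rw [h3, hup]
            exact TapeInv.inc (D := D) (k := k + 1) (K := []) (L := L) (rest := rest)
              (by rw [hw, List.replicate_succ']; simp) (by simpa using hv)
              (by rw [List.nil_append]; omega)
        · refine Or.inl ⟨step_tapeMachine_none D ?_, ?_⟩
          · rw [hcell, hg]
            simp [tapeMove, heldState, hun]
          · rw [hw, mem_nestLang_iff D (head?_append_ne hu hun)]
            exact ⟨fun h => (nomatch h), fun h => absurd h.2.1 (by simp)⟩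
      · have hu' : .t ∉ u ++ [c] := by simp [hu, Ne.symm hct]
        by_cases hcT : c = .T
        · subst hcT
          refine Or.inr ⟨_, _, 2 * 0 + 3 * L.length + 20,
              step_tapeMachine D (s' := (.dec, heldState D (u ++ [.T])))
            (g := some none) (m := .right) (m' := .right) ?_, ?_,
            Or.inl (Nat.lt_succ_self _)⟩
          · rw [hcell, hg, heldState_concat, ← heldState_getD]
            cases heldState D u <;> rfl
          · rw [h3, hup]
            have h := TapeInv.dec (D := D) (K := []) (L := L) hw' hu' (by simp)
              (by simp; omega) (by simpa using hL)
            simpa [HeadMove.apply, ← add_assoc] using h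
        · refine Or.inr ⟨_, _, L.length + 5,
              step_tapeMachine D (s' := (.main, heldState D (u ++ [c])))
            (g := some none) (m := .right) (m' := .stay) ?_, ?_,
            Or.inl (Nat.lt_succ_self _)⟩
          · rw [hcell, hg, heldState_concat, ← heldState_getD]
            cases c
            · exact absurd rfl hct
            · exact absurd rfl hcT
            all_goals cases heldState D u <;> rfl
          · rw [h3, hup]
            have h := TapeInv.main (D := D) (L := L) hw' hu' (by
              rw [List.count_append, List.count_singleton]
              simpa [hcT] using hv) hL
            simpa [HeadMove.apply, ← add_assoc] using h
  | @inc k rest K L hw hv hL =>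
    have hlen : w.length = k + rest.length := by simp [hw]
    have h3 : min (HeadMove.stay.apply (k + 1)) (w.length + 1) = k + 1 := by
      simp [HeadMove.apply, hlen]
    have hg := bitsTape_append K L _ rfl
    by_cases hb : ∃ L', L = true :: L'
    · obtain ⟨L, rfl⟩ := hb
      refine Or.inr ⟨_, _, 2 * (K ++ [false]).length + 3 * L.length + 20,
          step_tapeMachine D (s' := (.inc, none))
        (g := some (some false)) (m := .stay) (m' := .right) ?_, ?_, Or.inr ⟨rfl, ?_⟩⟩
      · rw [hg]
        rfl
      · rw [h3, update_bitsTape]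
        have h := TapeInv.inc (D := D) (K := K ++ [false]) (L := L) hw (by
          simp only [bitsVal_append, bitsVal, List.length_append, List.length_cons,
            List.length_nil, pow_add, Bool.toNat_false, Bool.toNat_true] at hv ⊢
          rw [← hv]
          ring) (by simpa using hL)
        simpa [HeadMove.apply] using h
      · simp
        omega
    · refine Or.inr ⟨_, _, (K ++ true :: L.tail).length + 6 + K.length,
          step_tapeMachine D (s' := (.back, none))
        (g := some (some true)) (m := .stay) (m' := .left) ?_, ?_, Or.inr ⟨rfl, ?_⟩⟩
      · rw [hg]
        rcases L with _ | ⟨_ | _, L⟩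
        · rfl
        · rfl
        · exact absurd ⟨L, rfl⟩ hb
      · rw [h3, update_bitsTape]
        refine TapeInv.back (D := D) (u := []) (L := K ++ true :: L.tail) (j := K.length) hw
          (by simp) ?_ ?_ (by simp)
        · rw [← hv, bitsVal_append, bitsVal_append]
          rcases L with _ | ⟨_ | _, L⟩
          · simp [bitsVal]
          · simp only [bitsVal, List.tail_cons, Bool.toNat_true, Bool.toNat_false, List.count_nil]
            ring
          · exact absurd ⟨L, rfl⟩ hb
        -- A new leading digit appears only when the carry runs past the last one; then `2 ^
        -- K.length ≤ k`, which keeps the bound on the number of digits.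
        · rcases L with _ | ⟨b, L⟩
          · have h2 : 2 ^ K.length ≤ k := by omega
            simp only [List.tail_nil, List.length_append, List.length_cons, List.length_nil,
              pow_succ, zero_add]
            omega
          · simpa using hL
      · rcases L with _ | ⟨b, L⟩ <;> simp <;> omega
  | @dec k u rest K L hw hu hne hv hL =>
    have hlen : w.length = k + u.length + rest.length := by simp [hw, add_assoc]
    have h3 : min (HeadMove.stay.apply (k + u.length + 1)) (w.length + 1) =
        k + u.length + 1 := by
      simp [HeadMove.apply, hlen]
    have hg := bitsTape_append K L _ rfl
    rcases L with _ | ⟨_ | _, L⟩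
    · refine Or.inl ⟨step_tapeMachine_none D ?_, ?_⟩
      · rw [hg]
        rfl
      · rw [hw, mem_nestLang_iff D (head?_append_ne hu hne)]
        refine ⟨fun h => (nomatch h), fun h => ?_⟩
        -- The borrow ran past the last digit. As `bitsVal K < 2 ^ K.length`, already `u` has more
        -- than `k` letters `T`.
        have h1 := h.2.2
        rw [List.count_append] at h1
        rw [List.append_nil] at hv
        have := bitsVal_lt K
        omega
    · refine Or.inr ⟨_, _, 2 * (K ++ [true]).length + 3 * L.length + 20,
          step_tapeMachine D (s' := (.dec, heldState D u))
        (g := some (some true)) (m := .stay) (m' := .right) ?_, ?_, Or.inr ⟨rfl, ?_⟩⟩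
      · rw [hg]
        rfl
      · rw [h3, update_bitsTape]
        have h := TapeInv.dec (D := D) (K := K ++ [true]) (L := L) hw hu hne (by
          simp only [bitsVal_append, bitsVal, List.length_append, List.length_cons,
            List.length_nil, pow_add, Bool.toNat_false, Bool.toNat_true] at hv ⊢
          linarith) (by simpa using hL)
        simpa [HeadMove.apply] using h
      · simp
        omega
    · refine Or.inr ⟨_, _, (K ++ false :: L).length + 6 + K.length,
          step_tapeMachine D (s' := (.back, heldState D u))
        (g := some (some false)) (m := .stay) (m' := .left) ?_, ?_, Or.inr ⟨rfl, ?_⟩⟩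
      · rw [hg]
        rfl
      · rw [h3, update_bitsTape]
        refine TapeInv.back (D := D) (L := K ++ false :: L) (j := K.length) hw hu ?_
          (by simpa using hL) (by simp)
        simp only [bitsVal_append, bitsVal, Bool.toNat_false, Bool.toNat_true] at hv ⊢
        linarith
      · simp
        omega
  | @back k u rest L j hw hu hv hL hj =>
    have hlen : w.length = k + u.length + rest.length := by simp [hw, add_assoc]
    have h3 : min (HeadMove.stay.apply (k + u.length + 1)) (w.length + 1) =
        k + u.length + 1 := by
      simp [HeadMove.apply, hlen]
    cases j with
    | zero =>
      refine Or.inr ⟨_, _, L.length + 5,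
          step_tapeMachine D (s' := (.main, heldState D u))
        (g := some none) (m := .stay) (m' := .stay) rfl, ?_, Or.inr ⟨rfl, ?_⟩⟩
      · rw [h3, show Function.update (bitsTape L) 0 (some none) = bitsTape L from
          Function.update_eq_self 0 (bitsTape L)]
        exact TapeInv.main hw hu hv hL
      · omega
    | succ j =>
      refine Or.inr ⟨_, _, L.length + 6 + j,
          step_tapeMachine D (s' := (.back, heldState D u))
        (g := bitsTape L (j + 1)) (m := .stay) (m' := .left) ?_, ?_, Or.inr ⟨rfl, ?_⟩⟩
      · have : bitsTape L (j + 1) = some (some L[j]) := by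
          simp [bitsTape, List.getElem?_eq_getElem (show j < L.length by omega)]
        rw [this]
        rfl
      · rw [h3, Function.update_eq_self]
        exact TapeInv.back (j := j) hw hu hv hL (by omega)
      · omega
  | @zero k u j L hw hu ha hv hL =>
    have hlen : w.length = k + u.length := by simp [hw]
    have h3 : min (HeadMove.stay.apply (k + u.length + 1)) (w.length + 1) =
        k + u.length + 1 := by
      simp [HeadMove.apply, hlen]
    have hg := bitsTape_append (List.replicate j false) L (j + 1) (by simp)
    have hmem : w ∈ nestLang D ↔ bitsVal L = 0 := by
      rw [hw, mem_nestLang_iff D (head?_ne_of_notMem hu)]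
      have h2 : 2 ^ j * bitsVal L = 0 ↔ bitsVal L = 0 := by simp
      rw [← h2]
      exact ⟨fun h => by have := h.2.2; omega, fun h => ⟨ha, hu, by omega⟩⟩
    rcases L with _ | ⟨_ | _, L⟩
    · refine Or.inr ⟨_, _, 0,
          step_tapeMachine D (s' := (.acc, heldState D u))
        (g := none) (m := .stay) (m' := .stay) ?_, ?_, Or.inr ⟨rfl, ?_⟩⟩
      · rw [hg]
        rfl
      · refine TapeInv.acc (hmem.2 rfl) ?_
        simp only [HeadMove.apply, Nat.add_sub_cancel]
        rw [List.length_nil, add_zero] at hL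
        omega
      · simp
    · refine Or.inr ⟨_, _, L.length + 1,
          step_tapeMachine D (s' := (.zero, heldState D u))
        (g := bitsTape (List.replicate j false ++ false :: L) (j + 1)) (m := .stay)
        (m' := .right) ?_, ?_, Or.inr ⟨rfl, ?_⟩⟩
      · rw [hg]
        rfl
      · rw [h3, Function.update_eq_self]
        have h := TapeInv.zero (D := D) (j := j + 1) (L := L) hw hu ha
          (by
            simp only [bitsVal, Bool.toNat_false] at hv
            rw [← hv]
            ring) (by
            rw [List.length_cons] at hL
            rwa [add_assoc, add_comm 1])
        rw [List.replicate_succ', List.append_assoc] at h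
        exact h
      · simp
    · refine Or.inl ⟨step_tapeMachine_none D ?_, ?_⟩
      · rw [hg]
        rfl
      · rw [hmem]
        refine ⟨fun h => (nomatch h), fun h => ?_⟩
        simp [bitsVal] at h
  | acc hw _ => exact Or.inl ⟨rfl, ⟨fun _ => hw, fun _ => rfl⟩⟩

theorem exists_tapeInv_of_reaches {w : List Letter}
    {c : WorkTapeCfg (Phase × Option σ) (Option (Option Bool))}
    (h : (tapeMachine D).Reaches w c) : ∃ r m, TapeInv D w c r m := by
  induction h with
  | refl => exact ⟨_, _, .init⟩
  | tail _ hs ih =>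
    obtain ⟨r, m, hi⟩ := ih
    rcases tapeMachine_progress D hi with ⟨h, -⟩ | ⟨d, r', m', h, hi', -⟩
    · rw [h] at hs
      cases hs
    · rw [h] at hs
      cases hs
      exact ⟨r', m', hi'⟩

theorem tapeMachine_decides : (tapeMachine D).Decides (nestLang D) := by
  intro w
  have key : ∀ (r m : ℕ) (c : WorkTapeCfg (Phase × Option σ) (Option (Option Bool))),
      TapeInv D w c r m → (tapeMachine D).Reaches w c →
      ∃ c, (tapeMachine D).Reaches w c ∧ (tapeMachine D).step w c = none ∧
        (c.state ∈ (tapeMachine D).accept ↔ w ∈ nestLang D) := by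
    intro r
    induction r using Nat.strong_induction_on with
    | _ r ihr =>
    intro m
    induction m using Nat.strong_induction_on with
    | _ m ihm =>
    intro c hi hc
    rcases tapeMachine_progress D hi with ⟨h, h'⟩ | ⟨d, r', m', h, hi', hlt⟩
    · exact ⟨c, hc, h, h'⟩
    · have hd := hc.tail h
      rcases hlt with hlt | ⟨rfl, hlt⟩
      · exact ihr r' hlt m' d hi' hd
      · exact ihm m' hlt d hi' hd
  exact key _ _ _ .init .refl

theorem lt_of_two_pow_le {l n : ℕ} (h : 2 ^ l ≤ 2 * n + 1) :
    l + 1 < 3 * (Nat.log 2 n + 1) := by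
  have h1 := Nat.lt_pow_succ_log_self (b := 2) (by norm_num) n
  have h2 : 2 ^ l < 2 ^ (Nat.log 2 n + 2) := by
    rw [pow_succ 2 (Nat.log 2 n + 1)]
    simp only [Nat.succ_eq_add_one] at h1
    omega
  have := (Nat.pow_lt_pow_iff_right (by norm_num : 1 < 2)).1 h2
  omega

theorem tapeMachine_usesLogSpace : (tapeMachine D).UsesLogSpace := by
  refine ⟨3, fun w c h => ?_⟩
  obtain ⟨r, m, hi⟩ := exists_tapeInv_of_reaches D h
  cases hi with
  | init => simp
  | main => simp
  | @inc k rest K L hw hv hL =>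
    have hk : k ≤ w.length := by simp [hw]
    have h1 := lt_of_two_pow_le (hL.trans (by omega : _ ≤ 2 * w.length + 1))
    simp only [List.length_append] at h1
    change K.length + 1 < _
    omega
  | @dec k u rest K L hw hu hne hv hL =>
    have hk : k ≤ w.length := by simp [hw]
    have h1 := lt_of_two_pow_le (hL.trans (by omega : _ ≤ 2 * w.length + 1))
    simp only [List.length_append] at h1
    change K.length + 1 < _
    omega
  | @back k u rest L j hw hu hv hL hj =>
    have hk : k ≤ w.length := by simp [hw]
    have h1 := lt_of_two_pow_le (hL.trans (by omega : _ ≤ 2 * w.length + 1))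
    change j < _
    omega
  | @zero k u j L hw hu ha hv hL =>
    have hk : k ≤ w.length := by simp [hw]
    have h1 := lt_of_two_pow_le (hL.trans (by omega : _ ≤ 2 * w.length + 1))
    change j + 1 < _
    omega
  | @acc o i j f hw hL =>
    have h1 := lt_of_two_pow_le hL
    change j < _
    omega

theorem isLogSpace_nestLang [Finite σ] : IsLogSpace (nestLang D) :=
  ⟨_, _, inferInstance, inferInstance, tapeMachine D, tapeMachine_decides D,
    tapeMachine_usesLogSpace D⟩

end LogSpace

end BSol

theorem corollary4p7 (p q : ℕ) (hp : 1 ≤ p) (hpq : p < q) :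
    (BSol.slopeLang p q).IsRegular ∧
    (p ∣ q → (BSol.semiHorocyclicLang p q).IsRegular) ∧
    (p ∣ q →
      BSol.IsDetLinearOneCounter (BSol.horocyclicLang p q) ∧
      BSol.IsUnambiguousLinear (BSol.horocyclicLang p q) ∧
      BSol.IsLogSpace (BSol.horocyclicLang p q) ∧
      BSol.IsRationalSeries (BSol.horocyclicGrowth p q)) := by
  refine ⟨BSol.isRegular_slopeLang hp hpq, fun hd => BSol.isRegular_semiHorocyclicLang hp hpq hd,
    fun hd => ?_⟩
  obtain ⟨σ, _, D, hD⟩ := BSol.isRegular_coreLang hp hpq hd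
  have ht : ∀ u ∈ D.accepts, .t ∉ u := by
    intro u hu
    rw [hD] at hu
    obtain ⟨n, l, rfl, -⟩ := hu.1
    exact BSol.t_notMem_slopeWord n l
  have hL : BSol.horocyclicLang p q = BSol.nestLang D := by
    ext w
    rw [BSol.mem_horocyclicLang_iff hp hpq hd, ← hD]
    exact ⟨fun ⟨u, hu, h⟩ => ⟨u, hu, ht u hu, h⟩, fun ⟨u, hu, _, h⟩ => ⟨u, hu, h⟩⟩
  rw [BSol.horocyclicGrowth_eq D hL ht, hL]
  exact ⟨BSol.isDetLinearOneCounter_nestLang D, BSol.isUnambiguousLinear_nestLang D,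
    BSol.isLogSpace_nestLang D, BSol.isRationalSeries_weightedSeries D D.start⟩
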